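/- Let $N,M$ be smooth ($C^\infty$, Hausdorff, boundaryless) manifolds of dimensions $n,m$, and let $f:N\to M$ be a smooth map. Write $f_*$ for the differential of $f$ and $f^*$ for its transpose. On $T^{big}M=TM\oplus T^*M$ consider the metric $g((X,\alpha),(Y,\beta))=\frac12(\alpha(Y)+\beta(X))$ and, for smooth sections, the Courant bracket $$[(X,\alpha),(Y,\beta)]=\big([X,Y],\,L_X\beta-L_Y\alpha+\tfrac12\,d(\alpha(Y)-\beta(X))\big).$$ A big-isotropic structure of rank $k$ ($0\le k\le m$) on $M$ is a smooth $g$-isotropic subbundle $E\subseteq T^{big}M$ of rank $k$; it is integrable if the space $\Gamma E$ of its smooth sections is closed under the Courant bracket. $S'$ denotes the $g$-orthogonal space of a subspace $S$ of a fibre. The same notions are used on $N$. For $x\in N$, $y=f(x)$ and a subspace $S\subseteq T_yM\oplus T_y^*M$ put $$f^*(S)=\{(X,f^*\alpha)\;:\;X\in T_xN,\ \alpha\in T_y^*M,\ (f_*X,\alpha)\in S\}\subseteq T_xN\oplus T_x^*N,$$ and let $\ker f^*_y$ be the kernel of $f^*:T_y^*M\to T_x^*N$, regarded as a subspace of $T_yM\oplus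 T^*_yM$. Let $E$ be a big-isotropic structure of rank $k$ on $M$. Then: 1. For every $x\in N$ and $y=f(x)$, the space $f^*(E_y)$ is isotropic and $(f^*(E_y))'=f^*(E'_y)$. 2. If $f$ is a smooth embedding, $E$ is integrable, and the spaces $f^*(E_{f(x)})$, $x\in N$, form a smooth subbundle $f^*E$ (of constant rank) of $T^{big}N$, then $f^*E$ is an integrable big-isotropic structure on $N$. 3. For every $x\in N$ and $y=f(x)$, $\dim f^*(E_y)=n-m+k$ if and only if $E_y\cap\ker f^*_y=E'_y\cap\ker f^*_y$. -/

import Mathlib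

open scoped Manifold ContDiff

noncomputable section

namespace BigIsotropic

/-! Throughout, manifolds are smooth, real, finite dimensional and without boundary; in the theorem
the model with corners `I` is `𝓡 m`. -/

section

variable {F : Type*} [NormedAddCommGroup F] [NormedSpace ℝ F]
  {H : Type*} [TopologicalSpace H] (I : ModelWithCorners ℝ F H)
  {M : Type*} [TopologicalSpace M] [ChartedSpace H M]

/-- The cotangent space `T*_x M`. -/
abbrev Cotangent (x : M) : Type _ := TangentSpace I x →L[ℝ] ℝ

/-- The fibre `T_x M ⊕ T*_x M` of the big tangent bundle. -/
abbrev BigTangent (x : M) : Type _ := TangentSpace I x × Cotangent I x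

/-- The neutral metric `g((X, α), (Y, β)) = (α(Y) + β(X)) / 2` on `T_x M ⊕ T*_x M`. -/
def metric (x : M) : LinearMap.BilinForm ℝ (BigTangent I x) :=
  LinearMap.mk₂ ℝ (fun a b => (1 / 2 : ℝ) * (a.2 b.1 + b.2 a.1))
    (fun a a' b => by
      simp only [Prod.fst_add, Prod.snd_add, map_add, add_apply]; ring)
    (fun c a b => by
      simp only [Prod.smul_fst, Prod.smul_snd, map_smul, smul_apply, smul_eq_mul]; ring)
    (fun a b b' => by
      simp only [Prod.fst_add, Prod.snd_add, map_add, add_apply]; ring)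
    (fun c a b => by
      simp only [Prod.smul_fst, Prod.smul_snd, map_smul, smul_apply, smul_eq_mul]; ring)

/-- The `g`-orthogonal space `S' = {b | g(a, b) = 0 for all a ∈ S}`. -/
def perp (x : M) (S : Submodule ℝ (BigTangent I x)) : Submodule ℝ (BigTangent I x) :=
  (metric I x).orthogonal S

/-- `S` is `g`-isotropic. -/
def IsIsotropic (x : M) (S : Submodule ℝ (BigTangent I x)) : Prop :=
  ∀ a ∈ S, ∀ b ∈ S, metric I x a b = 0

variable [IsManifold I ∞ M]

/-- The section `s = (X, α)` of `TM ⊕ T*M` is smooth on `U`: the vector field `X` and the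
`1`-form `α` are smooth on `U` as sections of the tangent bundle and of the bundle of continuous
linear maps from the tangent bundle to the trivial line bundle. -/
def IsSmoothOn (s : ∀ x : M, BigTangent I x) (U : Set M) : Prop :=
  ContMDiffOn I (I.prod 𝓘(ℝ, F)) ∞
    (fun x => Bundle.TotalSpace.mk' F (E := fun x : M => TangentSpace I x) x (s x).1) U ∧
  ContMDiffOn I (I.prod 𝓘(ℝ, F →L[ℝ] ℝ)) ∞
    (fun x => Bundle.TotalSpace.mk' (F →L[ℝ] ℝ)
      (E := fun x : M => TangentSpace I x →L[ℝ] Bundle.Trivial M ℝ x) x (s x).2) U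

/-- A field of subspaces `E_x ⊆ T_x M ⊕ T*_x M` is a smooth subbundle of rank `k`: near every
point it is spanned by `k` smooth, pointwise linearly independent local sections. -/
def IsSmoothSubbundle (k : ℕ) (E : ∀ x : M, Submodule ℝ (BigTangent I x)) : Prop :=
  ∀ x₀ : M, ∃ U : Set M, IsOpen U ∧ x₀ ∈ U ∧
    ∃ s : Fin k → ∀ x : M, BigTangent I x,
      (∀ i, IsSmoothOn I (s i) U) ∧
      ∀ x ∈ U, LinearIndependent ℝ (fun i => s i x) ∧
        E x = Submodule.span ℝ (Set.range fun i => s i x)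

/-- A big-isotropic structure of rank `k`, `0 ≤ k ≤ dim M`: a smooth `g`-isotropic subbundle of
rank `k` of the big tangent bundle. -/
structure IsBigIsotropic (k : ℕ) (E : ∀ x : M, Submodule ℝ (BigTangent I x)) : Prop where
  rank_le : k ≤ Module.finrank ℝ F
  smooth : IsSmoothSubbundle I k E
  isotropic : ∀ x, IsIsotropic I x (E x)

/-- The space `Γ(E)` of smooth global sections of `E`. -/
def sections (E : ∀ x : M, Submodule ℝ (BigTangent I x)) : Set (∀ x : M, BigTangent I x) :=
  {s | IsSmoothOn I s Set.univ ∧ ∀ x, s x ∈ E x}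

end

section

variable {F : Type*} [NormedAddCommGroup F] [NormedSpace ℝ F]
  {H : Type*} [TopologicalSpace H] (I : ModelWithCorners ℝ F H)
  {F' : Type*} [NormedAddCommGroup F'] [NormedSpace ℝ F']
  {H' : Type*} [TopologicalSpace H'] (J : ModelWithCorners ℝ F' H')
  {N : Type*} [TopologicalSpace N] [ChartedSpace H N]
  {M : Type*} [TopologicalSpace M] [ChartedSpace H' M]

/-- The transpose `f*_y : T*_y M → T*_x N`, `y = f(x)`, of the differential of `f` at `x`. -/
def cotangentMap (f : N → M) (x : N) (α : Cotangent J (f x)) : Cotangent I x :=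
  α.comp (mfderiv I J f x)

/-- The pullback
`f*(S) = {(X, f*α) | X ∈ T_x N, α ∈ T*_y M, (f_* X, α) ∈ S}` at `x` of a subspace
`S ⊆ T_y M ⊕ T*_y M`, where `y = f(x)`. -/
def pullback (f : N → M) (x : N) (S : Submodule ℝ (BigTangent J (f x))) :
    Submodule ℝ (BigTangent I x) where
  carrier := {p | ∃ α : Cotangent J (f x),
    p.2 = cotangentMap I J f x α ∧ (mfderiv I J f x p.1, α) ∈ S}
  add_mem' := by
    rintro a b ⟨α, ha, ha'⟩ ⟨β, hb, hb'⟩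
    refine ⟨α + β, ?_, ?_⟩
    · rw [Prod.snd_add, ha, hb]
      exact (ContinuousLinearMap.add_comp _ _ _).symm
    · simpa using S.add_mem ha' hb'
  zero_mem' := by
    refine ⟨0, ?_, ?_⟩
    · exact (ContinuousLinearMap.zero_comp _).symm
    · rw [Prod.fst_zero, map_zero]
      exact S.zero_mem
  smul_mem' := by
    rintro c a ⟨α, ha, ha'⟩
    refine ⟨c • α, ?_, ?_⟩
    · rw [Prod.smul_snd, ha]
      exact (ContinuousLinearMap.smul_comp _ _ _).symm
    · simpa using S.smul_mem c ha'

/-- The kernel of `f*_y`, regarded as the subspace `{(0, α) | f*α = 0}` of `T_y M ⊕ T*_y M`. -/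
def kerCotangentMap (f : N → M) (x : N) : Submodule ℝ (BigTangent J (f x)) where
  carrier := {p | p.1 = 0 ∧ cotangentMap I J f x p.2 = 0}
  add_mem' := by
    rintro a b ⟨ha, ha'⟩ ⟨hb, hb'⟩
    refine ⟨by simp [ha, hb], ?_⟩
    have h : cotangentMap I J f x (a + b).2
        = cotangentMap I J f x a.2 + cotangentMap I J f x b.2 :=
      ContinuousLinearMap.add_comp _ _ _
    rw [h, ha', hb', add_zero]
  zero_mem' := ⟨rfl, ContinuousLinearMap.zero_comp _⟩
  smul_mem' := by
    rintro c a ⟨ha, ha'⟩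
    refine ⟨by simp [ha], ?_⟩
    have h : cotangentMap I J f x (c • a).2 = c • cotangentMap I J f x a.2 :=
      ContinuousLinearMap.smul_comp _ _ _
    rw [h, ha', smul_zero]

end

section

variable {F : Type*} [NormedAddCommGroup F] [NormedSpace ℝ F]

/-- The Lie derivative of a `1`-form on a vector space,
`(L_X β)_i = X^j ∂_j β_i + β_j ∂_i X^j`. -/
def lieDerivVec (X : F → F) (β : F → F →L[ℝ] ℝ) (u : F) : F →L[ℝ] ℝ :=
  fderiv ℝ β u (X u) + (β u).comp (fderiv ℝ X u)

variable {H : Type*} [TopologicalSpace H] (I : ModelWithCorners ℝ F H)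
  {M : Type*} [TopologicalSpace M] [ChartedSpace H M]

/-- The Lie derivative `L_X β` of a `1`-form on a manifold: at `x` it is computed in the preferred
chart around `x`, to which `X` and `β` are transported, and the result is pulled back to `T*_x M`
(this is how Mathlib defines the Lie bracket of vector fields). -/
def lieDeriv (X : ∀ x : M, TangentSpace I x) (β : ∀ x : M, Cotangent I x) (x : M) :
    Cotangent I x :=
  let βc : F → F →L[ℝ] ℝ := fun u =>
    cotangentMap 𝓘(ℝ, F) I (extChartAt I x).symm u (β ((extChartAt I x).symm u))
  let Xc : F → F := VectorField.mpullback 𝓘(ℝ, F) I (extChartAt I x).symm X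
  cotangentMap I 𝓘(ℝ, F) (extChartAt I x) x (lieDerivVec (F := F) Xc βc (extChartAt I x x))

/-- The differential of a real function, as a `1`-form. -/
def differential (h : M → ℝ) (x : M) : Cotangent I x :=
  mfderiv I 𝓘(ℝ, ℝ) h x

/-- The Courant bracket
`[(X, α), (Y, β)] = ([X, Y], L_X β - L_Y α + d(α(Y) - β(X)) / 2)`. -/
def courant (a b : ∀ x : M, BigTangent I x) (x : M) : BigTangent I x :=
  (VectorField.mlieBracket I (fun z => (a z).1) (fun z => (b z).1) x,
    lieDeriv I (fun z => (a z).1) (fun z => (b z).2) x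
      - lieDeriv I (fun z => (b z).1) (fun z => (a z).2) x
      + (1 / 2 : ℝ) • differential I (fun z => (a z).2 (b z).1 - (b z).2 (a z).1) x)

/-- `Γ(E)` is closed under the Courant bracket. -/
def IsIntegrable [IsManifold I ∞ M] (E : ∀ x : M, Submodule ℝ (BigTangent I x)) : Prop :=
  ∀ a ∈ sections I E, ∀ b ∈ sections I E, courant I a b ∈ sections I E

end

end BigIsotropic

end

namespace BigIsotropic

section LinearAlgebra

variable {F : Type*} [NormedAddCommGroup F] [NormedSpace ℝ F]
  {H : Type*} [TopologicalSpace H] {I : ModelWithCorners ℝ F H}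
  {F' : Type*} [NormedAddCommGroup F'] [NormedSpace ℝ F']
  {H' : Type*} [TopologicalSpace H'] {J : ModelWithCorners ℝ F' H'}
  {N : Type*} [TopologicalSpace N] [ChartedSpace H N]
  {M : Type*} [TopologicalSpace M] [ChartedSpace H' M]

instance finiteDimensional_tangentSpace [FiniteDimensional ℝ F] (x : N) :
    FiniteDimensional ℝ (TangentSpace I x) :=
  inferInstanceAs (FiniteDimensional ℝ F)

instance t2Space_tangentSpace (x : N) : T2Space (TangentSpace I x) :=
  inferInstanceAs (T2Space F)

instance finiteDimensional_cotangent [FiniteDimensional ℝ F] (x : N) :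
    FiniteDimensional ℝ (Cotangent I x) :=
  inferInstanceAs (FiniteDimensional ℝ (F →L[ℝ] ℝ))

lemma finrank_tangentSpace (x : N) :
    Module.finrank ℝ (TangentSpace I x) = Module.finrank ℝ F := rfl

lemma finrank_cotangent [FiniteDimensional ℝ F] (x : N) :
    Module.finrank ℝ (Cotangent I x) = Module.finrank ℝ F := by
  change Module.finrank ℝ (F →L[ℝ] ℝ) = Module.finrank ℝ F
  rw [← (LinearMap.toContinuousLinearMap (𝕜 := ℝ) (E := F) (F' := ℝ)).finrank_eq]
  exact Subspace.dual_finrank_eq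

lemma finrank_bigTangent [FiniteDimensional ℝ F] (x : N) :
    Module.finrank ℝ (BigTangent I x) = 2 * Module.finrank ℝ F := by
  rw [Module.finrank_prod, finrank_cotangent, finrank_tangentSpace, two_mul]

lemma metric_apply (x : N) (a b : BigTangent I x) :
    metric I x a b = (1 / 2 : ℝ) * (a.2 b.1 + b.2 a.1) := rfl

lemma mem_perp {x : N} {S : Submodule ℝ (BigTangent I x)} {b : BigTangent I x} :
    b ∈ perp I x S ↔ ∀ a ∈ S, a.2 b.1 + b.2 a.1 = 0 := by
  simp [perp, LinearMap.BilinForm.mem_orthogonal_iff, metric_apply]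

lemma metric_isRefl (x : N) : (metric I x).IsRefl := fun a b h => by
  rw [metric_apply] at h ⊢
  rw [add_comm]; exact h

/-- A linear functional separating a vector from a subspace of a tangent space. -/
lemma exists_cotangent_ne_zero [FiniteDimensional ℝ F] {x : N}
    (p : Submodule ℝ (TangentSpace I x)) {v : TangentSpace I x} (hv : v ∉ p) :
    ∃ α : Cotangent I x, α v ≠ 0 ∧ ∀ w ∈ p, α w = 0 := by
  obtain ⟨g, hg, hgp⟩ := p.exists_le_ker_of_notMem hv
  exact ⟨LinearMap.toContinuousLinearMap g, hg, fun w hw => hgp hw⟩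

lemma metric_nondegenerate [FiniteDimensional ℝ F] (x : N) : (metric I x).Nondegenerate := by
  refine (LinearMap.IsRefl.nondegenerate_iff_separatingLeft (metric_isRefl x)).2 ?_
  rintro ⟨X, α⟩ h
  have hX : X = 0 := by
    by_contra hX
    obtain ⟨β, hβ, -⟩ := exists_cotangent_ne_zero (I := I) (x := x) ⊥ (v := X) (by simpa using hX)
    have := h (0, β)
    simp [metric_apply, hβ] at this
  have hα : α = 0 := by
    ext Y
    have := h (Y, 0)
    simpa [metric_apply] using this
  rw [hX, hα]; rfl

lemma finrank_perp [FiniteDimensional ℝ F] {x : N} (S : Submodule ℝ (BigTangent I x)) :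
    Module.finrank ℝ (perp I x S) + Module.finrank ℝ S = 2 * Module.finrank ℝ F := by
  have h := LinearMap.BilinForm.finrank_orthogonal (metric_nondegenerate (I := I) x) S
  have h' := S.finrank_le
  rw [finrank_bigTangent] at h h'
  change Module.finrank ℝ (perp I x S) = _ at h
  omega

lemma perp_perp [FiniteDimensional ℝ F] {x : N} (S : Submodule ℝ (BigTangent I x)) :
    perp I x (perp I x S) = S :=
  LinearMap.BilinForm.orthogonal_orthogonal (metric_nondegenerate (I := I) x) (metric_isRefl x) S

lemma perp_sup {x : N} (S T : Submodule ℝ (BigTangent I x)) :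
    perp I x (S ⊔ T) = perp I x S ⊓ perp I x T := by
  refine le_antisymm (le_inf (LinearMap.BilinForm.orthogonal_le le_sup_left)
    (LinearMap.BilinForm.orthogonal_le le_sup_right)) ?_
  rintro b ⟨hS, hT⟩ _ h
  obtain ⟨s, hs, t, ht, rfl⟩ := Submodule.mem_sup.1 h
  have h1 : metric I x s b = 0 := hS s hs
  have h2 : metric I x t b = 0 := hT t ht
  change metric I x (s + t) b = 0
  rw [map_add, LinearMap.add_apply, h1, h2, add_zero]

lemma isIsotropic_iff_le_perp {x : N} {S : Submodule ℝ (BigTangent I x)} :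
    IsIsotropic I x S ↔ S ≤ perp I x S :=
  ⟨fun h _ hb a ha => h a ha _ hb, fun h a ha _ hb => h hb a ha⟩

/-- The linear map `(X, α) ↦ (f_* X, α)`. -/
noncomputable def pushVector (I : ModelWithCorners ℝ F H) (J : ModelWithCorners ℝ F' H')
    (f : N → M) (x : N) :
    TangentSpace I x × Cotangent J (f x) →ₗ[ℝ] BigTangent J (f x) :=
  (mfderiv I J f x).toLinearMap.prodMap LinearMap.id

/-- The linear map `(X, α) ↦ (X, f^* α)`. -/
noncomputable def pullCovector (I : ModelWithCorners ℝ F H) (J : ModelWithCorners ℝ F' H')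
    (f : N → M) (x : N) :
    TangentSpace I x × Cotangent J (f x) →ₗ[ℝ] BigTangent I x where
  toFun p := (p.1, cotangentMap I J f x p.2)
  map_add' _ _ := Prod.ext rfl (ContinuousLinearMap.add_comp _ _ _)
  map_smul' _ _ := Prod.ext rfl (ContinuousLinearMap.smul_comp _ _ _)

lemma pullback_eq_map_comap (f : N → M) (x : N) (S : Submodule ℝ (BigTangent J (f x))) :
    pullback I J f x S = (S.comap (pushVector I J f x)).map (pullCovector I J f x) := by
  ext ⟨X, ξ⟩
  constructor
  · rintro ⟨α, hξ, hα⟩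
    exact ⟨(X, α), hα, Prod.ext rfl hξ.symm⟩
  · rintro ⟨⟨Y, α⟩, hα, h⟩
    obtain ⟨rfl, rfl⟩ := Prod.mk.inj h
    exact ⟨α, rfl, hα⟩

lemma finrank_map_add_finrank_ker_inf {V W : Type*} [AddCommGroup V] [Module ℝ V]
    [FiniteDimensional ℝ V] [AddCommGroup W] [Module ℝ W] (g : V →ₗ[ℝ] W) (S : Submodule ℝ V) :
    Module.finrank ℝ (S.map g) + Module.finrank ℝ (LinearMap.ker g ⊓ S : Submodule ℝ V) =
      Module.finrank ℝ S := by
  rw [← LinearMap.finrank_range_add_finrank_ker (g.domRestrict S), LinearMap.range_domRestrict,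
    LinearMap.ker_domRestrict, inf_comm, ← Submodule.map_comap_subtype,
    Submodule.finrank_map_subtype_eq]

variable [FiniteDimensional ℝ F] [FiniteDimensional ℝ F']

omit [FiniteDimensional ℝ F] in
lemma range_pushVector (f : N → M) (x : N) :
    LinearMap.range (pushVector I J f x) = perp J (f x) (kerCotangentMap I J f x) := by
  ext ⟨Y, β⟩
  rw [mem_perp]
  constructor
  · rintro ⟨⟨X, α⟩, h⟩ ⟨Z, γ⟩ ⟨hZ, hγ⟩
    obtain ⟨rfl, rfl⟩ := Prod.mk.inj h
    have h1 : γ (mfderiv I J f x X) = 0 := DFunLike.congr_fun hγ X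
    change γ (mfderiv I J f x X) + α Z = 0
    rw [h1, show Z = 0 from hZ, map_zero, add_zero]
  · intro h
    by_contra hY
    have hY' : Y ∉ LinearMap.range (mfderiv I J f x).toLinearMap := by
      rintro ⟨X, rfl⟩
      exact hY ⟨(X, β), rfl⟩
    obtain ⟨α, hα, hα'⟩ := exists_cotangent_ne_zero _ hY'
    refine hα ?_
    have := h (0, α) ⟨rfl, ContinuousLinearMap.ext fun X => hα' _ ⟨X, rfl⟩⟩
    simpa using this

lemma finrank_pullback (f : N → M) (x : N) (S : Submodule ℝ (BigTangent J (f x))) :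
    Module.finrank ℝ (pullback I J f x S) +
        Module.finrank ℝ (S ⊓ kerCotangentMap I J f x : Submodule ℝ (BigTangent J (f x))) +
        Module.finrank ℝ F' =
      Module.finrank ℝ F + Module.finrank ℝ S +
        Module.finrank ℝ
          (perp J (f x) S ⊓ kerCotangentMap I J f x : Submodule ℝ (BigTangent J (f x))) := by
  set K := kerCotangentMap I J f x with hK
  set φ := pushVector I J f x with hφ
  set ψ := pullCovector I J f x with hψ
  have h1 := finrank_map_add_finrank_ker_inf ψ (S.comap φ)
  rw [← pullback_eq_map_comap] at h1
  have h2 := finrank_map_add_finrank_ker_inf φ (S.comap φ)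
  rw [inf_eq_left.2 (LinearMap.ker_le_comap φ), Submodule.map_comap_eq] at h2
  have h3 := finrank_map_add_finrank_ker_inf φ (LinearMap.ker ψ ⊓ S.comap φ)
  have h4 : (LinearMap.ker ψ ⊓ S.comap φ).map φ = S ⊓ K := by
    ext ⟨Y, β⟩
    constructor
    · rintro ⟨⟨X, α⟩, ⟨hX, hS⟩, h⟩
      obtain ⟨h1, h2⟩ := Prod.mk.inj (show (X, cotangentMap I J f x α) = (0, 0) from hX)
      obtain ⟨rfl, rfl⟩ := Prod.mk.inj h
      exact ⟨hS, by change mfderiv I J f x X = 0; rw [h1, map_zero], h2⟩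
    · rintro ⟨hS, hY, hβ⟩
      obtain rfl : Y = 0 := hY
      have h0 : φ (0, β) = (0, β) := Prod.ext (map_zero (mfderiv I J f x)) rfl
      exact ⟨(0, β), ⟨Prod.ext rfl hβ, by change φ (0, β) ∈ S; rwa [h0]⟩, h0⟩
  have h5 : LinearMap.ker φ ⊓ (LinearMap.ker ψ ⊓ S.comap φ) = ⊥ := by
    rw [eq_bot_iff]
    rintro ⟨X, α⟩ ⟨h1, h2, -⟩
    exact Prod.ext (Prod.mk.inj (show (X, cotangentMap I J f x α) = (0, 0) from h2)).1
      (Prod.mk.inj (show (mfderiv I J f x X, α) = (0, 0) from h1)).2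
  rw [h4, h5, finrank_bot] at h3
  have h6 := LinearMap.finrank_range_add_finrank_ker φ
  rw [Module.finrank_prod, finrank_tangentSpace, finrank_cotangent] at h6
  have hr : LinearMap.range φ = perp J (f x) K := range_pushVector f x
  have h7 := finrank_perp K
  rw [← hr] at h7
  have h8 := finrank_perp (perp J (f x) S ⊔ K)
  rw [perp_sup, perp_perp, ← hr, inf_comm] at h8
  have h9 := Submodule.finrank_sup_add_finrank_inf_eq (perp J (f x) S) K
  have h10 := finrank_perp S
  omega

omit [FiniteDimensional ℝ F] [FiniteDimensional ℝ F'] in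
lemma pullback_perp_le (f : N → M) (x : N) (S : Submodule ℝ (BigTangent J (f x))) :
    pullback I J f x (perp J (f x) S) ≤ perp I x (pullback I J f x S) := by
  rintro ⟨X, _⟩ ⟨α, rfl, hα⟩
  rw [mem_perp]
  rintro ⟨Y, _⟩ ⟨β, rfl, hβ⟩
  exact mem_perp.1 hα _ hβ

lemma perp_pullback (f : N → M) (x : N) (S : Submodule ℝ (BigTangent J (f x))) :
    perp I x (pullback I J f x S) = pullback I J f x (perp J (f x) S) := by
  refine (Submodule.eq_of_le_of_finrank_le (pullback_perp_le f x S) ?_).symm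
  have h1 := finrank_pullback (I := I) f x S
  have h2 := finrank_pullback (I := I) f x (perp J (f x) S)
  rw [perp_perp] at h2
  have h3 := finrank_perp S
  have h4 := finrank_perp (pullback I J f x S)
  omega

omit [FiniteDimensional ℝ F] [FiniteDimensional ℝ F'] in
lemma IsIsotropic.pullback {f : N → M} {x : N} {S : Submodule ℝ (BigTangent J (f x))}
    (hS : IsIsotropic J (f x) S) : IsIsotropic I x (pullback I J f x S) := by
  rintro ⟨X, _⟩ ⟨α, rfl, hα⟩ ⟨Y, _⟩ ⟨β, rfl, hβ⟩
  exact hS _ hα _ hβ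

lemma IsIsotropic.finrank_le {x : N} {S : Submodule ℝ (BigTangent I x)}
    (hS : IsIsotropic I x S) : Module.finrank ℝ S ≤ Module.finrank ℝ F := by
  have h1 := Submodule.finrank_mono (isIsotropic_iff_le_perp.1 hS)
  have h2 := finrank_perp S
  omega

lemma finrank_pullback_eq_iff {f : N → M} {x : N} {S : Submodule ℝ (BigTangent J (f x))}
    (hS : IsIsotropic J (f x) S) :
    (Module.finrank ℝ (BigIsotropic.pullback I J f x S) : ℤ) =
        (Module.finrank ℝ F : ℤ) - Module.finrank ℝ F' + Module.finrank ℝ S ↔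
      S ⊓ kerCotangentMap I J f x = perp J (f x) S ⊓ kerCotangentMap I J f x := by
  have h1 := finrank_pullback (I := I) f x S
  have hle : S ⊓ kerCotangentMap I J f x ≤ perp J (f x) S ⊓ kerCotangentMap I J f x :=
    inf_le_inf_right _ (isIsotropic_iff_le_perp.1 hS)
  constructor
  · intro h
    exact Submodule.eq_of_le_of_finrank_le hle (by omega)
  · intro h
    rw [← h] at h1
    omega

end LinearAlgebra

lemma IsSmoothSubbundle.finrank_eq {F : Type*} [NormedAddCommGroup F] [NormedSpace ℝ F]
    {H : Type*} [TopologicalSpace H] {I : ModelWithCorners ℝ F H}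
    {M : Type*} [TopologicalSpace M] [ChartedSpace H M] [IsManifold I ∞ M] {k : ℕ}
    {E : ∀ x : M, Submodule ℝ (BigTangent I x)} (hE : IsSmoothSubbundle I k E) (x : M) :
    Module.finrank ℝ (E x) = k := by
  obtain ⟨U, -, hx, s, -, hs⟩ := hE x
  rw [(hs x hx).2, finrank_span_eq_card (hs x hx).1, Fintype.card_fin]

section LinearSystem

variable {E V : Type*} [NormedAddCommGroup E] [NormedSpace ℝ E]
  [NormedAddCommGroup V] [NormedSpace ℝ V] [FiniteDimensional ℝ V]

/-- A family of vectors depending smoothly on a parameter: near a parameter where the span has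
maximal dimension, every smooth vector field with values in the span is a combination of the
family with smooth coefficients. -/
lemma exists_contDiffOn_coefficients {k : ℕ} {Ω : Set E} (hΩ : IsOpen Ω) (hne : Ω.Nonempty)
    (A : E → Fin k → V) (hA : ∀ i, ContDiffOn ℝ ∞ (fun u => A u i) Ω) :
    ∃ Ω' ⊆ Ω, IsOpen Ω' ∧ Ω'.Nonempty ∧ ∀ b : E → V, ContDiffOn ℝ ∞ b Ω →
      (∀ u ∈ Ω, b u ∈ Submodule.span ℝ (Set.range (A u))) →
      ∃ c : Fin k → E → ℝ, (∀ i, ContDiffOn ℝ ∞ (c i) Ω') ∧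
        ∀ u ∈ Ω', ∑ i, c i u • A u i = b u := by
  classical
  let r : E → ℕ := fun u => Module.finrank ℝ (Submodule.span ℝ (Set.range (A u)))
  obtain ⟨u₀, hu₀, hmax⟩ : ∃ u₀ ∈ Ω, ∀ u ∈ Ω, r u ≤ r u₀ := by
    obtain ⟨_, ⟨u₀, hu₀, rfl⟩, h⟩ := (wellFounded_lt (α := ℕ)).has_min
      ((fun u => Module.finrank ℝ V - r u) '' Ω) (hne.image _)
    refine ⟨u₀, hu₀, fun u hu => ?_⟩
    have h1 := h _ ⟨u, hu, rfl⟩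
    have h2 : r u ≤ Module.finrank ℝ V := Submodule.finrank_le _
    have h3 : r u₀ ≤ Module.finrank ℝ V := Submodule.finrank_le _
    simp only [not_lt] at h1
    omega
  obtain ⟨κ, a, ha, hspan, hli⟩ := exists_linearIndependent' ℝ (A u₀)
  have : Finite κ := Finite.of_injective a ha
  have := Fintype.ofFinite κ
  have hcard : Fintype.card κ = r u₀ := by
    rw [← finrank_span_eq_card hli, hspan]
  obtain ⟨L₀, hL₀⟩ := LinearMap.exists_leftInverse_of_injective
    (Fintype.linearCombination ℝ (A u₀ ∘ a)) (LinearMap.ker_eq_bot.2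
      (linearIndependent_iff_injective_fintypeLinearCombination.1 hli))
  let L : V →L[ℝ] (κ → ℝ) := LinearMap.toContinuousLinearMap L₀
  let T : E → (κ → ℝ) →L[ℝ] (κ → ℝ) := fun u =>
    ∑ j, (ContinuousLinearMap.proj (R := ℝ) (φ := fun _ : κ => ℝ) j).smulRight (L (A u (a j)))
  have hT : ∀ u d, T u d = L (∑ j, d j • A u (a j)) := by
    intro u d
    simp [T]
  have hTsmooth : ContDiffOn ℝ ∞ T Ω := by
    refine ContDiffOn.sum fun j _ => ?_
    exact (ContinuousLinearMap.contDiff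
      (ContinuousLinearMap.smulRightL ℝ (κ → ℝ) (κ → ℝ)
        (ContinuousLinearMap.proj (R := ℝ) (φ := fun _ : κ => ℝ) j))).comp_contDiffOn
      (L.contDiff.comp_contDiffOn (hA (a j)))
  have hT₀ : T u₀ = 1 := by
    ext1 d
    rw [hT]
    exact LinearMap.congr_fun hL₀ d
  refine ⟨Ω ∩ T ⁻¹' {t | IsUnit t}, Set.inter_subset_left,
    hTsmooth.continuousOn.isOpen_inter_preimage hΩ Units.isOpen, ⟨u₀, hu₀, ?_⟩, ?_⟩
  · change IsUnit (T u₀)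
    rw [hT₀]
    exact isUnit_one
  intro b hb hbA
  let d : E → κ → ℝ := fun u => Ring.inverse (T u) (L (b u))
  have hd : ContDiffOn ℝ ∞ d (Ω ∩ T ⁻¹' {t | IsUnit t}) := by
    intro u hu
    have hinv : ContDiffAt ℝ ∞ Ring.inverse (T u) := by
      obtain ⟨t, ht⟩ := hu.2
      rw [← ht]
      exact contDiffAt_ringInverse ℝ t
    exact (hinv.comp_contDiffWithinAt u ((hTsmooth u hu.1).mono Set.inter_subset_left)).clm_apply
      (L.contDiff.contDiffAt.comp_contDiffWithinAt u ((hb u hu.1).mono Set.inter_subset_left))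
  refine ⟨fun i u => ∑ j, if a j = i then d u j else 0, fun i => ?_, fun u hu => ?_⟩
  · refine ContDiffOn.sum fun j _ => ?_
    split_ifs
    · exact (contDiffOn_pi.1 hd) j
    · exact contDiffOn_const
  · have hinj : Function.Injective (Fintype.linearCombination ℝ (A u ∘ a)) := by
      intro d₁ d₂ h
      have h' : T u d₁ = T u d₂ := by
        rw [hT, hT]
        exact congrArg L h
      obtain ⟨t, ht⟩ := hu.2
      rw [← ht] at h'
      simpa [← mul_apply_eq_comp] using
        congrArg (↑t⁻¹ : (κ → ℝ) →L[ℝ] (κ → ℝ)) h'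
    have hli' := linearIndependent_iff_injective_fintypeLinearCombination.2 hinj
    have hspan' : Submodule.span ℝ (Set.range (A u ∘ a)) = Submodule.span ℝ (Set.range (A u)) := by
      refine Submodule.eq_of_le_of_finrank_le
        (Submodule.span_mono (Set.range_comp_subset_range _ _)) ?_
      rw [finrank_span_eq_card hli', hcard]
      exact hmax u hu.1
    have hbu := hbA u hu.1
    rw [← hspan', Submodule.mem_span_range_iff_exists_fun] at hbu
    obtain ⟨e, he⟩ := hbu
    have hde : d u = e := by
      have h1 : L (b u) = T u e := by
        rw [hT, ← he]
        rfl
      change Ring.inverse (T u) (L (b u)) = e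
      rw [h1]
      change (Ring.inverse (T u) * T u) e = e
      rw [Ring.inverse_mul_cancel _ hu.2]
      rfl
    rw [← he]
    simp only [Finset.sum_smul, ite_smul, zero_smul, hde]
    rw [Finset.sum_comm]
    simp

end LinearSystem

section Naturality

variable {E₁ E₂ : Type*} [NormedAddCommGroup E₁] [NormedSpace ℝ E₁]
  [NormedAddCommGroup E₂] [NormedSpace ℝ E₂] {G : E₁ → E₂} {u : E₁}
  {X X₁ X₂ : E₁ → E₁} {Y Y₁ Y₂ : E₂ → E₂} {ξ : E₁ → E₁ →L[ℝ] ℝ} {β : E₂ → E₂ →L[ℝ] ℝ}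

open Filter Topology

lemma fderiv_related (hG : ContDiffAt ℝ 2 G u) (hX : DifferentiableAt ℝ X u)
    (hY : DifferentiableAt ℝ Y (G u)) (h : ∀ᶠ v in 𝓝 u, Y (G v) = fderiv ℝ G v (X v)) (w : E₁) :
    fderiv ℝ Y (G u) (fderiv ℝ G u w) =
      fderiv ℝ (fderiv ℝ G) u w (X u) + fderiv ℝ G u (fderiv ℝ X u w) := by
  have hG1 : DifferentiableAt ℝ G u := hG.differentiableAt (by norm_num)
  have hG2 : DifferentiableAt ℝ (fderiv ℝ G) u :=
    (hG.fderiv_right (m := 1) (by norm_num)).differentiableAt (by norm_num)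
  have h1 : fderiv ℝ (fun v => Y (G v)) u w = fderiv ℝ (fun v => fderiv ℝ G v (X v)) u w := by
    rw [EventuallyEq.fderiv_eq h]
  rw [fderiv_clm_apply hG2 hX, show (fun v => Y (G v)) = Y ∘ G from rfl,
    fderiv_comp u hY hG1] at h1
  simp only [ContinuousLinearMap.comp_apply, add_apply, ContinuousLinearMap.flip_apply] at h1
  rw [h1, add_comm]

lemma lieBracket_related (hG : ContDiffAt ℝ 2 G u) (hX₁ : DifferentiableAt ℝ X₁ u)
    (hX₂ : DifferentiableAt ℝ X₂ u) (hY₁ : DifferentiableAt ℝ Y₁ (G u))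
    (hY₂ : DifferentiableAt ℝ Y₂ (G u)) (h₁ : ∀ᶠ v in 𝓝 u, Y₁ (G v) = fderiv ℝ G v (X₁ v))
    (h₂ : ∀ᶠ v in 𝓝 u, Y₂ (G v) = fderiv ℝ G v (X₂ v)) :
    VectorField.lieBracket ℝ Y₁ Y₂ (G u) = fderiv ℝ G u (VectorField.lieBracket ℝ X₁ X₂ u) := by
  have hs : IsSymmSndFDerivAt ℝ G u := hG.isSymmSndFDerivAt (by simp)
  rw [VectorField.lieBracket_eq, VectorField.lieBracket_eq]
  simp only
  rw [h₁.self_of_nhds, h₂.self_of_nhds, fderiv_related hG hX₂ hY₂ h₂,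
    fderiv_related hG hX₁ hY₁ h₁, hs.eq, map_sub]
  abel

lemma lieDerivVec_related (hG : ContDiffAt ℝ 2 G u) (hX : DifferentiableAt ℝ X u)
    (hY : DifferentiableAt ℝ Y (G u)) (hβ : DifferentiableAt ℝ β (G u))
    (h : ∀ᶠ v in 𝓝 u, Y (G v) = fderiv ℝ G v (X v))
    (hξ : ∀ᶠ v in 𝓝 u, ξ v = (β (G v)).comp (fderiv ℝ G v)) :
    (lieDerivVec Y β (G u)).comp (fderiv ℝ G u) = lieDerivVec X ξ u := by
  have hG1 : DifferentiableAt ℝ G u := hG.differentiableAt (by norm_num)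
  have hG2 : DifferentiableAt ℝ (fderiv ℝ G) u :=
    (hG.fderiv_right (m := 1) (by norm_num)).differentiableAt (by norm_num)
  have hs : IsSymmSndFDerivAt ℝ G u := hG.isSymmSndFDerivAt (by simp)
  have hβG : DifferentiableAt ℝ (fun v => β (G v)) u := hβ.comp u hG1
  ext w
  have h1 : fderiv ℝ ξ u (X u) w = β (G u) (fderiv ℝ (fderiv ℝ G) u (X u) w) +
      fderiv ℝ β (G u) (fderiv ℝ G u (X u)) (fderiv ℝ G u w) := by
    rw [EventuallyEq.fderiv_eq hξ, fderiv_clm_comp hβG hG2,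
      show (fun v => β (G v)) = β ∘ G from rfl, fderiv_comp u hβ hG1]
    simp
  simp only [lieDerivVec, ContinuousLinearMap.comp_apply, add_apply]
  rw [h1, hξ.self_of_nhds, h.self_of_nhds, fderiv_related hG hX hY h, map_add, hs.eq]
  simp only [ContinuousLinearMap.comp_apply]
  ring

end Naturality

section Coordinates

open Filter Topology

variable {F : Type*} [NormedAddCommGroup F] [NormedSpace ℝ F]
  {H : Type*} [TopologicalSpace H] (I : ModelWithCorners ℝ F H)
  {M : Type*} [TopologicalSpace M] [ChartedSpace H M]

/-- A vector field, read in the preferred chart around `x₀`. -/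
noncomputable def coordVec (x₀ : M) (X : ∀ x : M, TangentSpace I x) : F → F :=
  VectorField.mpullback 𝓘(ℝ, F) I (extChartAt I x₀).symm X

/-- A `1`-form, read in the preferred chart around `x₀`. -/
noncomputable def coordForm (x₀ : M) (β : ∀ x : M, Cotangent I x) : F → F →L[ℝ] ℝ := fun u =>
  cotangentMap 𝓘(ℝ, F) I (extChartAt I x₀).symm u (β ((extChartAt I x₀).symm u))

/-- The differential of the preferred chart around `x₀`, with values in the model space. -/
noncomputable def chartDeriv (x₀ x : M) : TangentSpace I x →L[ℝ] F :=
  mfderiv I 𝓘(ℝ, F) (extChartAt I x₀) x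

variable {I} [I.Boundaryless] [IsManifold I ∞ M] {x₀ x : M}

lemma chartDeriv_comp_mfderiv_symm {u : F} (hu : u ∈ (extChartAt I x₀).target) :
    (chartDeriv I x₀ ((extChartAt I x₀).symm u)).comp
      (mfderiv 𝓘(ℝ, F) I (extChartAt I x₀).symm u) = ContinuousLinearMap.id ℝ F := by
  have := mfderiv_extChartAt_comp_mfderivWithin_extChartAt_symm hu
  rwa [I.range_eq_univ, mfderivWithin_univ] at this

lemma mfderiv_symm_comp_chartDeriv {u : F} (hu : u ∈ (extChartAt I x₀).target) :
    (mfderiv 𝓘(ℝ, F) I (extChartAt I x₀).symm u).comp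
      (chartDeriv I x₀ ((extChartAt I x₀).symm u)) =
        ContinuousLinearMap.id ℝ (TangentSpace I ((extChartAt I x₀).symm u)) := by
  have := mfderivWithin_extChartAt_symm_comp_mfderiv_extChartAt hu
  rwa [I.range_eq_univ, mfderivWithin_univ] at this

omit [I.Boundaryless] in
lemma chartDeriv_bijective (hx : x ∈ (extChartAt I x₀).source) :
    Function.Bijective (chartDeriv I x₀ x) := by
  obtain ⟨e, he⟩ := isInvertible_mfderiv_extChartAt hx
  rw [chartDeriv, ← he]
  exact e.bijective

lemma coordVec_of_mem_target (X : ∀ x : M, TangentSpace I x) {u : F}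
    (hu : u ∈ (extChartAt I x₀).target) :
    coordVec I x₀ X u =
      chartDeriv I x₀ ((extChartAt I x₀).symm u) (X ((extChartAt I x₀).symm u)) := by
  have hinv := isInvertible_mfderivWithin_extChartAt_symm hu
  rw [I.range_eq_univ, mfderivWithin_univ] at hinv
  refine (hinv.inverse_apply_eq).2 ?_
  exact (DFunLike.congr_fun (mfderiv_symm_comp_chartDeriv hu) _).symm

lemma coordVec_chart (X : ∀ x : M, TangentSpace I x) (hx : x ∈ (extChartAt I x₀).source) :
    coordVec I x₀ X (extChartAt I x₀ x) = chartDeriv I x₀ x (X x) := by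
  rw [coordVec_of_mem_target X ((extChartAt I x₀).map_source hx)]
  exact congrArg (fun z => chartDeriv I x₀ z (X z)) ((extChartAt I x₀).left_inv hx)

lemma coordForm_comp_chartDeriv (β : ∀ x : M, Cotangent I x)
    (hx : x ∈ (extChartAt I x₀).source) :
    (coordForm I x₀ β (extChartAt I x₀ x)).comp (chartDeriv I x₀ x) = β x := by
  have h : ∀ z, z = (extChartAt I x₀).symm (extChartAt I x₀ x) →
      (coordForm I x₀ β (extChartAt I x₀ x)).comp (chartDeriv I x₀ z) = β z := by
    rintro _ rfl
    ext v
    exact congrArg (β ((extChartAt I x₀).symm (extChartAt I x₀ x))) (DFunLike.congr_fun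
      (mfderiv_symm_comp_chartDeriv ((extChartAt I x₀).map_source hx)) v)
  exact h x ((extChartAt I x₀).left_inv hx).symm

lemma coordForm_apply_coordVec (β : ∀ x : M, Cotangent I x) (X : ∀ x : M, TangentSpace I x)
    (hx : x ∈ (extChartAt I x₀).source) :
    coordForm I x₀ β (extChartAt I x₀ x) (coordVec I x₀ X (extChartAt I x₀ x)) = β x (X x) := by
  rw [coordVec_chart X hx, ← coordForm_comp_chartDeriv β hx]
  rfl

/-- The part of the target of the preferred chart around `x₀` that corresponds to `U`. -/
def chartImage (I : ModelWithCorners ℝ F H) (x₀ : M) (U : Set M) : Set F :=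
  (extChartAt I x₀).target ∩ (extChartAt I x₀).symm ⁻¹' U

omit [IsManifold I ∞ M] in
lemma isOpen_chartImage {U : Set M} (hU : IsOpen U) : IsOpen (chartImage I x₀ U) :=
  (continuousOn_extChartAt_symm x₀).isOpen_inter_preimage (isOpen_extChartAt_target x₀) hU

omit [IsManifold I ∞ M] [I.Boundaryless] in
lemma extChartAt_mem_chartImage {U : Set M} (hx : x ∈ (extChartAt I x₀).source) (hU : x ∈ U) :
    extChartAt I x₀ x ∈ chartImage I x₀ U :=
  ⟨(extChartAt I x₀).map_source hx, by
    change (extChartAt I x₀).symm (extChartAt I x₀ x) ∈ U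
    rwa [(extChartAt I x₀).left_inv hx]⟩

omit [I.Boundaryless] in
lemma contMDiffOn_iff_contDiffOn_chartImage {F' : Type*} [NormedAddCommGroup F']
    [NormedSpace ℝ F'] {U : Set M} (hUs : U ⊆ (extChartAt I x₀).source)
    {h : M → F'} {g : F → F'} (hg : ∀ x ∈ U, h x = g (extChartAt I x₀ x)) :
    ContMDiffOn I 𝓘(ℝ, F') ∞ h U ↔ ContDiffOn ℝ ∞ g (chartImage I x₀ U) := by
  constructor
  · intro hh
    rw [← contMDiffOn_iff_contDiffOn]
    refine (hh.comp ((contMDiffOn_extChartAt_symm x₀).mono Set.inter_subset_left)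
      fun u hu => hu.2).congr fun u hu => ?_
    rw [Function.comp_apply, hg _ hu.2, (extChartAt I x₀).right_inv hu.1]
  · intro hh
    refine ((contMDiffOn_iff_contDiffOn.2 hh).comp (contMDiffOn_extChartAt.mono ?_)
      fun x hx => extChartAt_mem_chartImage (hUs hx) hx).congr fun x hx => hg x hx
    rwa [← extChartAt_source (I := I)]

lemma contMDiffOn_iff_coordVec {X : ∀ x : M, TangentSpace I x} {U : Set M} (hU : IsOpen U)
    (hUs : U ⊆ (extChartAt I x₀).source) :
    ContMDiffOn I (I.prod 𝓘(ℝ, F)) ∞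
      (fun x => Bundle.TotalSpace.mk' F (E := fun x : M => TangentSpace I x) x (X x)) U ↔
    ContDiffOn ℝ ∞ (coordVec I x₀ X) (chartImage I x₀ U) := by
  have hUs' : U ⊆ (chartAt H x₀).source := by rwa [← extChartAt_source (I := I)]
  rw [(trivializationAt F (TangentSpace I) x₀).contMDiffOn_section_iff hU hUs']
  refine contMDiffOn_iff_contDiffOn_chartImage hUs fun x hx => ?_
  rw [coordVec_chart X (hUs hx), chartDeriv,
    ← TangentBundle.continuousLinearMapAt_trivializationAt (hUs' hx),
    Bundle.Trivialization.continuousLinearMapAt_apply]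
  rw [Bundle.Trivialization.coe_linearMapAt_of_mem _ (hUs' hx)]

lemma contMDiffOn_iff_coordForm {β : ∀ x : M, Cotangent I x} {U : Set M} (hU : IsOpen U)
    (hUs : U ⊆ (extChartAt I x₀).source) :
    ContMDiffOn I (I.prod 𝓘(ℝ, F →L[ℝ] ℝ)) ∞
      (fun x => Bundle.TotalSpace.mk' (F →L[ℝ] ℝ)
        (E := fun x : M => TangentSpace I x →L[ℝ] Bundle.Trivial M ℝ x) x (β x)) U ↔
    ContDiffOn ℝ ∞ (coordForm I x₀ β) (chartImage I x₀ U) := by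
  have hUs' : U ⊆ (chartAt H x₀).source := by rwa [← extChartAt_source (I := I)]
  rw [(trivializationAt (F →L[ℝ] ℝ)
    (fun x : M => TangentSpace I x →L[ℝ] Bundle.Trivial M ℝ x) x₀).contMDiffOn_section_iff hU
    (fun x hx => ⟨hUs' hx, Set.mem_univ _⟩)]
  refine contMDiffOn_iff_contDiffOn_chartImage hUs fun x hx => ?_
  rw [hom_trivializationAt_apply]
  ext v
  obtain ⟨w, rfl⟩ := (chartDeriv_bijective (hUs hx)).2 v
  rw [show coordForm I x₀ β (extChartAt I x₀ x) (chartDeriv I x₀ x w) = β x w from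
    DFunLike.congr_fun (coordForm_comp_chartDeriv β (hUs hx)) w, chartDeriv,
    ← TangentBundle.continuousLinearMapAt_trivializationAt (hUs' hx)]
  change (Bundle.Trivialization.continuousLinearMapAt ℝ
    (trivializationAt ℝ (Bundle.Trivial M ℝ) x₀) x).comp ((β x).comp _) _ = _
  rw [show Bundle.Trivialization.continuousLinearMapAt ℝ
    (trivializationAt ℝ (Bundle.Trivial M ℝ) x₀) x = ContinuousLinearMap.id ℝ ℝ from
      Bundle.Trivial.continuousLinearMapAt_trivialization ℝ M ℝ x]
  exact congrArg (β x) (Bundle.Trivialization.symmL_continuousLinearMapAt (R := ℝ)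
    (trivializationAt F (TangentSpace I) x₀) (hUs' hx) w)

lemma isSmoothOn_iff_coord {s : ∀ x : M, BigTangent I x} {U : Set M} (hU : IsOpen U)
    (hUs : U ⊆ (extChartAt I x₀).source) :
    IsSmoothOn I s U ↔
      ContDiffOn ℝ ∞ (coordVec I x₀ fun z => (s z).1) (chartImage I x₀ U) ∧
      ContDiffOn ℝ ∞ (coordForm I x₀ fun z => (s z).2) (chartImage I x₀ U) :=
  and_congr (contMDiffOn_iff_coordVec hU hUs) (contMDiffOn_iff_coordForm hU hUs)

omit [I.Boundaryless] in
lemma IsSmoothOn.mono {s : ∀ x : M, BigTangent I x} {U V : Set M} (hs : IsSmoothOn I s V)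
    (h : U ⊆ V) : IsSmoothOn I s U :=
  ⟨hs.1.mono h, hs.2.mono h⟩

omit [I.Boundaryless] in
lemma isSmoothOn_of_locally {s : ∀ x : M, BigTangent I x} {U : Set M}
    (h : ∀ x ∈ U, ∃ V, IsOpen V ∧ x ∈ V ∧ IsSmoothOn I s V) : IsSmoothOn I s U := by
  constructor
  · intro x hx
    obtain ⟨V, hV, hxV, hs⟩ := h x hx
    exact (hs.1.contMDiffAt (hV.mem_nhds hxV)).contMDiffWithinAt
  · intro x hx
    obtain ⟨V, hV, hxV, hs⟩ := h x hx
    exact (hs.2.contMDiffAt (hV.mem_nhds hxV)).contMDiffWithinAt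

/-- Coordinates of a section that is smooth near `x` are smooth near the image of `x`. -/
lemma IsSmoothOn.contDiffAt_coord {s : ∀ x : M, BigTangent I x} {U : Set M}
    (hs : IsSmoothOn I s U) (hU : IsOpen U) (hxU : x ∈ U) (hx : x ∈ (extChartAt I x₀).source) :
    ContDiffAt ℝ ∞ (coordVec I x₀ fun z => (s z).1) (extChartAt I x₀ x) ∧
      ContDiffAt ℝ ∞ (coordForm I x₀ fun z => (s z).2) (extChartAt I x₀ x) := by
  have hO : IsOpen (U ∩ (extChartAt I x₀).source) := hU.inter (isOpen_extChartAt_source x₀)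
  have h := (isSmoothOn_iff_coord hO Set.inter_subset_right).1 (hs.mono Set.inter_subset_left)
  have hn := (isOpen_chartImage hO).mem_nhds (extChartAt_mem_chartImage hx ⟨hxU, hx⟩)
  exact ⟨h.1.contDiffAt hn, h.2.contDiffAt hn⟩

lemma chartDeriv_modelSpace (u₀ u : F) :
    chartDeriv 𝓘(ℝ, F) u₀ u = ContinuousLinearMap.id ℝ F := by
  rw [chartDeriv, extChartAt_model_space_eq_id]
  exact mfderiv_id

lemma coordVec_modelSpace (u₀ : F) (X : F → F) : coordVec 𝓘(ℝ, F) u₀ X = X := by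
  ext u
  have h := coordVec_chart (I := 𝓘(ℝ, F)) (x₀ := u₀) (x := u) X
    (by rw [extChartAt_model_space_eq_id]; trivial)
  rw [chartDeriv_modelSpace] at h
  rwa [extChartAt_model_space_eq_id] at h

lemma coordForm_modelSpace (u₀ : F) (β : F → F →L[ℝ] ℝ) : coordForm 𝓘(ℝ, F) u₀ β = β := by
  ext1 u
  have h := coordForm_comp_chartDeriv (I := 𝓘(ℝ, F)) (x₀ := u₀) (x := u) β
    (by rw [extChartAt_model_space_eq_id]; trivial)
  rw [chartDeriv_modelSpace] at h
  rwa [extChartAt_model_space_eq_id] at h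

/-- A pair of a vector field and a `1`-form on a vector space, as a section of its big tangent
bundle. -/
def vecSection (X : F → F) (β : F → F →L[ℝ] ℝ) : ∀ u : F, BigTangent 𝓘(ℝ, F) u :=
  fun u => (X u, β u)

lemma isSmoothOn_vecSection_iff {X : F → F} {β : F → F →L[ℝ] ℝ} {U : Set F} (hU : IsOpen U) :
    IsSmoothOn 𝓘(ℝ, F) (vecSection X β) U ↔ ContDiffOn ℝ ∞ X U ∧ ContDiffOn ℝ ∞ β U := by
  rw [isSmoothOn_iff_coord (x₀ := 0) hU
    (by rw [extChartAt_model_space_eq_id]; exact Set.subset_univ U)]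
  have h1 : coordVec 𝓘(ℝ, F) (0 : F) (fun z => (vecSection X β z).1) = X :=
    coordVec_modelSpace 0 X
  have h2 : coordForm 𝓘(ℝ, F) (0 : F) (fun z => (vecSection X β z).2) = β :=
    coordForm_modelSpace 0 β
  rw [h1, h2]
  rw [chartImage, extChartAt_model_space_eq_id]
  simp

end Coordinates

section Naturality

open Filter Topology

variable {F : Type*} [NormedAddCommGroup F] [NormedSpace ℝ F]
  {H : Type*} [TopologicalSpace H] {I : ModelWithCorners ℝ F H} [I.Boundaryless]
  {F' : Type*} [NormedAddCommGroup F'] [NormedSpace ℝ F']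
  {H' : Type*} [TopologicalSpace H'] {J : ModelWithCorners ℝ F' H'} [J.Boundaryless]
  {N : Type*} [TopologicalSpace N] [ChartedSpace H N] [IsManifold I ∞ N]
  {M : Type*} [TopologicalSpace M] [ChartedSpace H' M] [IsManifold J ∞ M]

/-- The values at `x` and `f x` of the sections `a` and `b` are related by `f`: if `a = (X, ξ)` and
`b = (Y, β)` then `f_* X = Y` and `ξ = f^* β`. -/
def Related (I : ModelWithCorners ℝ F H) (J : ModelWithCorners ℝ F' H') (f : N → M)
    (a : ∀ x : N, BigTangent I x) (b : ∀ y : M, BigTangent J y) (x : N) : Prop :=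
  mfderiv I J f x (a x).1 = (b (f x)).1 ∧ (a x).2 = cotangentMap I J f x (b (f x)).2

/-- The map `f`, read in the preferred charts around `x₀` and `y₀`. -/
noncomputable def coordMap (I : ModelWithCorners ℝ F H) (J : ModelWithCorners ℝ F' H') (f : N → M)
    (x₀ : N) (y₀ : M) : F → F' :=
  extChartAt J y₀ ∘ f ∘ (extChartAt I x₀).symm

variable {f : N → M} {x₀ x : N} {y₀ : M}

omit [I.Boundaryless] [J.Boundaryless] [IsManifold I ∞ N] [IsManifold J ∞ M] in
lemma coordMap_chart (hx : x ∈ (extChartAt I x₀).source) :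
    coordMap I J f x₀ y₀ (extChartAt I x₀ x) = extChartAt J y₀ (f x) := by
  simp only [coordMap, Function.comp_apply, (extChartAt I x₀).left_inv hx]

omit [J.Boundaryless] in
lemma contDiffAt_coordMap (hf : ContMDiffAt I J ∞ f x) (hx : x ∈ (extChartAt I x₀).source)
    (hy : f x ∈ (extChartAt J y₀).source) :
    ContDiffAt ℝ ∞ (coordMap I J f x₀ y₀) (extChartAt I x₀ x) := by
  rw [extChartAt_source] at hx hy
  have h := (contMDiffAt_iff_of_mem_source hx hy).1 hf
  rw [I.range_eq_univ] at h
  exact h.2.contDiffAt univ_mem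

omit [J.Boundaryless] in
lemma fderiv_coordMap_comp_chartDeriv (hf : ContMDiffAt I J ∞ f x)
    (hx : x ∈ (extChartAt I x₀).source) (hy : f x ∈ (extChartAt J y₀).source) :
    (fderiv ℝ (coordMap I J f x₀ y₀) (extChartAt I x₀ x)).comp (chartDeriv I x₀ x) =
      (chartDeriv J y₀ (f x)).comp (mfderiv I J f x) := by
  have hG := (contDiffAt_coordMap hf hx hy).differentiableAt (by simp)
  have hx' := mdifferentiableAt_extChartAt (I := I) (x := x₀) (y := x)
    (by rwa [extChartAt_source] at hx)
  have hy' := mdifferentiableAt_extChartAt (I := J) (x := y₀) (y := f x)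
    (by rwa [extChartAt_source] at hy)
  have h1 := mfderiv_comp x hG.mdifferentiableAt hx'
  have h2 := mfderiv_comp x hy' (hf.mdifferentiableAt (by simp))
  have h3 : coordMap I J f x₀ y₀ ∘ extChartAt I x₀ =ᶠ[𝓝 x] extChartAt J y₀ ∘ f := by
    filter_upwards [(isOpen_extChartAt_source x₀).mem_nhds hx] with z hz
    exact coordMap_chart hz
  rw [h3.mfderiv_eq, h2, mfderiv_eq_fderiv] at h1
  exact h1.symm

/-- Relatedness of sections can be checked in charts. -/
lemma related_iff_coord {a : ∀ x : N, BigTangent I x} {b : ∀ y : M, BigTangent J y}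
    (hf : ContMDiffAt I J ∞ f x) (hx : x ∈ (extChartAt I x₀).source)
    (hy : f x ∈ (extChartAt J y₀).source) :
    Related I J f a b x ↔
      coordVec J y₀ (fun z => (b z).1) (coordMap I J f x₀ y₀ (extChartAt I x₀ x)) =
        fderiv ℝ (coordMap I J f x₀ y₀) (extChartAt I x₀ x)
          (coordVec I x₀ (fun z => (a z).1) (extChartAt I x₀ x)) ∧
      coordForm I x₀ (fun z => (a z).2) (extChartAt I x₀ x) =
        (coordForm J y₀ (fun z => (b z).2) (coordMap I J f x₀ y₀ (extChartAt I x₀ x))).comp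
          (fderiv ℝ (coordMap I J f x₀ y₀) (extChartAt I x₀ x)) := by
  have hd := fderiv_coordMap_comp_chartDeriv hf hx hy
  rw [coordMap_chart hx, coordVec_chart _ hx, coordVec_chart _ hy]
  refine and_congr ?_ ?_
  · rw [show fderiv ℝ (coordMap I J f x₀ y₀) (extChartAt I x₀ x) (chartDeriv I x₀ x (a x).1) =
      chartDeriv J y₀ (f x) (mfderiv I J f x (a x).1) from DFunLike.congr_fun hd (a x).1]
    exact ⟨fun h => congrArg _ h.symm, fun h => (chartDeriv_bijective hy).1 h.symm⟩
  · have h1 := coordForm_comp_chartDeriv (fun z => (a z).2) hx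
    have h2 : ((coordForm J y₀ (fun z => (b z).2) (extChartAt J y₀ (f x))).comp
        (fderiv ℝ (coordMap I J f x₀ y₀) (extChartAt I x₀ x))).comp (chartDeriv I x₀ x) =
          cotangentMap I J f x (b (f x)).2 := by
      rw [ContinuousLinearMap.comp_assoc, hd, ← coordForm_comp_chartDeriv (fun z => (b z).2) hy]
      rfl
    constructor
    · intro h
      ext v
      obtain ⟨w, rfl⟩ := (chartDeriv_bijective hx).2 v
      exact DFunLike.congr_fun (h1.trans (h.trans h2.symm)) w
    · intro h
      rw [← h2, ← h]
      exact h1.symm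

lemma mlieBracket_eq_coord (X Y : ∀ x : N, TangentSpace I x) (x : N) :
    chartDeriv I x x (VectorField.mlieBracket I X Y x) =
      VectorField.lieBracket ℝ (coordVec I x X) (coordVec I x Y) (extChartAt I x x) := by
  have h1 : VectorField.mlieBracket I X Y x = (chartDeriv I x x).inverse
      (VectorField.lieBracket ℝ (coordVec I x X) (coordVec I x Y) (extChartAt I x x)) := by
    have h2 : VectorField.lieBracketWithin ℝ (coordVec I x X) (coordVec I x Y) Set.univ =
      VectorField.lieBracket ℝ (coordVec I x X) (coordVec I x Y) :=
      VectorField.lieBracketWithin_univ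
    rw [VectorField.mlieBracket, VectorField.mlieBracketWithin, I.range_eq_univ]
    simp only [Set.preimage_univ, Set.inter_univ, VectorField.mpullbackWithin_univ]
    exact congrArg (fun L : F → F => (chartDeriv I x x).inverse
      (L (extChartAt I x x))) h2
  have hinv : (chartDeriv I x x).IsInvertible :=
    isInvertible_mfderiv_extChartAt (mem_extChartAt_source x)
  exact (hinv.inverse_apply_eq.1 h1.symm).symm

omit [I.Boundaryless] [IsManifold I ∞ N] in
lemma lieDeriv_eq_coord (X : ∀ x : N, TangentSpace I x) (β : ∀ x : N, Cotangent I x) (x : N) :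
    lieDeriv I X β x =
      (lieDerivVec (coordVec I x X) (coordForm I x β) (extChartAt I x x)).comp
        (chartDeriv I x x) := rfl

/-- The pairing of two smooth sections is a smooth function. -/
lemma IsSmoothOn.contMDiffAt_pairing {a b : ∀ x : N, BigTangent I x} {U : Set N}
    (ha : IsSmoothOn I a U) (hb : IsSmoothOn I b U) (hU : IsOpen U) (hxU : x ∈ U) :
    ContMDiffAt I 𝓘(ℝ, ℝ) ∞ (fun z => (a z).2 (b z).1) x := by
  have hx := mem_extChartAt_source (I := I) x
  have h := (ha.contDiffAt_coord hU hxU hx).2.clm_apply (hb.contDiffAt_coord hU hxU hx).1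
  refine (h.contMDiffAt.comp x contMDiffAt_extChartAt).congr_of_eventuallyEq ?_
  filter_upwards [(isOpen_extChartAt_source x).mem_nhds hx] with z hz
  exact (coordForm_apply_coordVec (fun z => (a z).2) (fun z => (b z).1) hz).symm

/-- The Courant bracket is natural: brackets of `f`-related sections are `f`-related. -/
lemma courant_related {a₁ a₂ : ∀ x : N, BigTangent I x} {b₁ b₂ : ∀ y : M, BigTangent J y}
    {U : Set N} {V : Set M} (hU : IsOpen U) (hxU : x ∈ U) (hV : IsOpen V) (hxV : f x ∈ V)
    (hf : ContMDiffOn I J ∞ f U) (ha₁ : IsSmoothOn I a₁ U) (ha₂ : IsSmoothOn I a₂ U)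
    (hb₁ : IsSmoothOn J b₁ V) (hb₂ : IsSmoothOn J b₂ V)
    (h₁ : ∀ z ∈ U, Related I J f a₁ b₁ z) (h₂ : ∀ z ∈ U, Related I J f a₂ b₂ z) :
    Related I J f (courant I a₁ a₂) (courant J b₁ b₂) x := by
  have hx := mem_extChartAt_source (I := I) x
  have hy := mem_extChartAt_source (I := J) (f x)
  have hfx := hf.contMDiffAt (hU.mem_nhds hxU)
  have hG : ContDiffAt ℝ 2 (coordMap I J f x (f x)) (extChartAt I x x) :=
    (contDiffAt_coordMap hfx hx hy).of_le ENat.LEInfty.out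
  have hGx : coordMap I J f x (f x) (extChartAt I x x) = extChartAt J (f x) (f x) :=
    coordMap_chart hx
  have hd := fderiv_coordMap_comp_chartDeriv hfx hx hy
  have hnear : ∀ᶠ v in 𝓝 (extChartAt I x x), ∃ z ∈ U, z ∈ (extChartAt I x).source ∧
      f z ∈ (extChartAt J (f x)).source ∧ ContMDiffAt I J ∞ f z ∧ v = extChartAt I x z := by
    have hO : IsOpen (U ∩ (extChartAt I x).source ∩ f ⁻¹' (extChartAt J (f x)).source) := by
      rw [Set.inter_right_comm]
      exact (hf.continuousOn.isOpen_inter_preimage hU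
        (isOpen_extChartAt_source (f x))).inter (isOpen_extChartAt_source x)
    filter_upwards [(isOpen_chartImage (I := I) (x₀ := x) hO).mem_nhds
      (extChartAt_mem_chartImage hx ⟨⟨hxU, hx⟩, hy⟩)] with v hv
    exact ⟨_, hv.2.1.1, hv.2.1.2, hv.2.2, hf.contMDiffAt (hU.mem_nhds hv.2.1.1),
      ((extChartAt I x).right_inv hv.1).symm⟩
  have hrel : ∀ (a : ∀ x : N, BigTangent I x) (b : ∀ y : M, BigTangent J y),
      (∀ z ∈ U, Related I J f a b z) → ∀ᶠ v in 𝓝 (extChartAt I x x),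
      coordVec J (f x) (fun z => (b z).1) (coordMap I J f x (f x) v) =
        fderiv ℝ (coordMap I J f x (f x)) v (coordVec I x (fun z => (a z).1) v) ∧
      coordForm I x (fun z => (a z).2) v =
        (coordForm J (f x) (fun z => (b z).2) (coordMap I J f x (f x) v)).comp
          (fderiv ℝ (coordMap I J f x (f x)) v) := by
    intro a b hab
    filter_upwards [hnear] with v hv
    obtain ⟨z, hzU, hz, hfz, hfz', rfl⟩ := hv
    exact (related_iff_coord hfz' hz hfz).1 (hab z hzU)
  have dA₁ := ha₁.contDiffAt_coord hU hxU hx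
  have dA₂ := ha₂.contDiffAt_coord hU hxU hx
  have dB₁ := hb₁.contDiffAt_coord hV hxV hy
  have dB₂ := hb₂.contDiffAt_coord hV hxV hy
  rw [← hGx] at dB₁ dB₂
  have hsmooth : (∞ : WithTop ℕ∞) ≠ 0 := by simp
  have hX := lieBracket_related hG (dA₁.1.differentiableAt hsmooth) (dA₂.1.differentiableAt hsmooth)
    (dB₁.1.differentiableAt hsmooth) (dB₂.1.differentiableAt hsmooth)
    ((hrel _ _ h₁).mono fun _ h => h.1) ((hrel _ _ h₂).mono fun _ h => h.1)
  have hL₁ := lieDerivVec_related hG (dA₁.1.differentiableAt hsmooth)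
    (dB₁.1.differentiableAt hsmooth) (dB₂.2.differentiableAt hsmooth)
    ((hrel _ _ h₁).mono fun _ h => h.1) ((hrel _ _ h₂).mono fun _ h => h.2)
  have hL₂ := lieDerivVec_related hG (dA₂.1.differentiableAt hsmooth)
    (dB₂.1.differentiableAt hsmooth) (dB₁.2.differentiableAt hsmooth)
    ((hrel _ _ h₂).mono fun _ h => h.1) ((hrel _ _ h₁).mono fun _ h => h.2)
  rw [hGx] at hX hL₁ hL₂
  have hpull : ∀ (X : ∀ x : N, TangentSpace I x) (ξ : ∀ x : N, Cotangent I x)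
      (Y : ∀ y : M, TangentSpace J y) (β : ∀ y : M, Cotangent J y),
      (lieDerivVec (coordVec J (f x) Y) (coordForm J (f x) β) (extChartAt J (f x) (f x))).comp
        (fderiv ℝ (coordMap I J f x (f x)) (extChartAt I x x)) =
          lieDerivVec (coordVec I x X) (coordForm I x ξ) (extChartAt I x x) →
      lieDeriv I X ξ x = cotangentMap I J f x (lieDeriv J Y β (f x)) := by
    intro X ξ Y β h
    rw [lieDeriv_eq_coord, lieDeriv_eq_coord, ← h, ContinuousLinearMap.comp_assoc, hd]
    rfl
  have hdiff : differential I (fun z => (a₁ z).2 (a₂ z).1 - (a₂ z).2 (a₁ z).1) x =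
      cotangentMap I J f x
        (differential J (fun z => (b₁ z).2 (b₂ z).1 - (b₂ z).2 (b₁ z).1) (f x)) := by
    have hb := ((hb₁.contMDiffAt_pairing hb₂ hV hxV).sub
      (hb₂.contMDiffAt_pairing hb₁ hV hxV)).mdifferentiableAt hsmooth
    refine Eq.trans (EventuallyEq.mfderiv_eq ?_)
      (mfderiv_comp x hb (hfx.mdifferentiableAt hsmooth))
    filter_upwards [hU.mem_nhds hxU] with z hz
    change _ = (b₁ (f z)).2 (b₂ (f z)).1 - (b₂ (f z)).2 (b₁ (f z)).1
    rw [← (h₁ z hz).1, ← (h₂ z hz).1, (h₁ z hz).2, (h₂ z hz).2]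
    rfl
  constructor
  · refine (chartDeriv_bijective hy).1 ?_
    refine (DFunLike.congr_fun hd _).symm.trans ?_
    refine Eq.trans ?_ (mlieBracket_eq_coord _ _ _).symm
    refine Eq.trans ?_ hX.symm
    exact congrArg _ (mlieBracket_eq_coord _ _ _)
  · change lieDeriv I (fun z => (a₁ z).1) (fun z => (a₂ z).2) x -
      lieDeriv I (fun z => (a₂ z).1) (fun z => (a₁ z).2) x + (1 / 2 : ℝ) • differential I _ x = _
    rw [hpull _ _ _ _ hL₁, hpull _ _ _ _ hL₂, hdiff]
    ext v
    rfl

end Naturality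

section CourantSmooth

open Filter Topology

variable {F : Type*} [NormedAddCommGroup F] [NormedSpace ℝ F]
  {H : Type*} [TopologicalSpace H] {I : ModelWithCorners ℝ F H} [I.Boundaryless]
  {M : Type*} [TopologicalSpace M] [ChartedSpace H M] [IsManifold I ∞ M] {x₀ x : M}

/-- A section is related by the inverse of a chart to its coordinates. -/
lemma related_extChartAt_symm (a : ∀ x : M, BigTangent I x) {u : F}
    (hu : u ∈ (extChartAt I x₀).target) :
    Related 𝓘(ℝ, F) I (extChartAt I x₀).symm
      (vecSection (coordVec I x₀ fun z => (a z).1) (coordForm I x₀ fun z => (a z).2)) a u := by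
  have hinv := isInvertible_mfderivWithin_extChartAt_symm hu
  rw [I.range_eq_univ, mfderivWithin_univ] at hinv
  exact ⟨(hinv.inverse_apply_eq.1 rfl).symm, rfl⟩

lemma courant_vecSection (X Y : F → F) (α β : F → F →L[ℝ] ℝ) (u : F) :
    courant 𝓘(ℝ, F) (vecSection X α) (vecSection Y β) u =
      vecSection (VectorField.lieBracket ℝ X Y)
        (fun u => lieDerivVec X β u - lieDerivVec Y α u +
          (1 / 2 : ℝ) • fderiv ℝ (fun z => α z (Y z) - β z (X z)) u) u := by
  have hL : ∀ (X : F → F) (β : F → F →L[ℝ] ℝ),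
      lieDeriv 𝓘(ℝ, F) (M := F) X β u = lieDerivVec X β u := by
    intro X β
    have h := lieDeriv_eq_coord (I := 𝓘(ℝ, F)) (N := F) X β u
    rw [coordVec_modelSpace, coordForm_modelSpace, chartDeriv_modelSpace] at h
    exact h
  refine Prod.ext ?_ ?_
  · have h := mlieBracket_eq_coord (I := 𝓘(ℝ, F)) (N := F) X Y u
    rwa [coordVec_modelSpace, coordVec_modelSpace, chartDeriv_modelSpace] at h
  · have hd : differential 𝓘(ℝ, F) (fun z => α z (Y z) - β z (X z)) u =
        fderiv ℝ (fun z => α z (Y z) - β z (X z)) u := mfderiv_eq_fderiv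
    exact congrArg₂ (fun p q : F →L[ℝ] ℝ => p + (1 / 2 : ℝ) • q)
      (congrArg₂ (fun p q : F →L[ℝ] ℝ => p - q) (hL X β) (hL Y α)) hd

lemma contDiffOn_lieDerivVec {X : F → F} {β : F → F →L[ℝ] ℝ} {U : Set F} (hU : IsOpen U)
    (hX : ContDiffOn ℝ ∞ X U) (hβ : ContDiffOn ℝ ∞ β U) :
    ContDiffOn ℝ ∞ (lieDerivVec X β) U :=
  ((hβ.fderiv_of_isOpen hU le_rfl).clm_apply hX).add
    (hβ.clm_comp (hX.fderiv_of_isOpen hU le_rfl))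

lemma contDiffOn_lieBracket {X Y : F → F} {U : Set F} (hU : IsOpen U)
    (hX : ContDiffOn ℝ ∞ X U) (hY : ContDiffOn ℝ ∞ Y U) :
    ContDiffOn ℝ ∞ (VectorField.lieBracket ℝ X Y) U :=
  ((hY.fderiv_of_isOpen hU le_rfl).clm_apply hX).sub
    ((hX.fderiv_of_isOpen hU le_rfl).clm_apply hY)

/-- The Courant bracket of smooth sections is smooth. -/
lemma IsSmoothOn.courant {a b : ∀ x : M, BigTangent I x} {U : Set M} (hU : IsOpen U)
    (ha : IsSmoothOn I a U) (hb : IsSmoothOn I b U) : IsSmoothOn I (courant I a b) U := by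
  refine isSmoothOn_of_locally fun x₀ hx₀ => ?_
  have hV : IsOpen (U ∩ (extChartAt I x₀).source) := hU.inter (isOpen_extChartAt_source x₀)
  refine ⟨_, hV, ⟨hx₀, mem_extChartAt_source x₀⟩, ?_⟩
  replace ha := ha.mono (U := U ∩ (extChartAt I x₀).source) Set.inter_subset_left
  replace hb := hb.mono (U := U ∩ (extChartAt I x₀).source) Set.inter_subset_left
  rw [isSmoothOn_iff_coord hV Set.inter_subset_right]
  have hO := isOpen_chartImage (I := I) (x₀ := x₀) hV
  have ha' := (isSmoothOn_iff_coord hV Set.inter_subset_right).1 ha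
  have hb' := (isSmoothOn_iff_coord hV Set.inter_subset_right).1 hb
  have hrel : ∀ u ∈ chartImage I x₀ (U ∩ (extChartAt I x₀).source), _ := fun u hu =>
    courant_related hO hu hV hu.2
      ((contMDiffOn_extChartAt_symm x₀).mono Set.inter_subset_left)
      ((isSmoothOn_vecSection_iff hO).2 ha') ((isSmoothOn_vecSection_iff hO).2 hb') ha hb
      (fun u hu => related_extChartAt_symm a hu.1) (fun u hu => related_extChartAt_symm b hu.1)
  have hbr := contDiffOn_lieBracket hO ha'.1 hb'.1
  have hform := ((contDiffOn_lieDerivVec hO ha'.1 hb'.2).sub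
    (contDiffOn_lieDerivVec hO hb'.1 ha'.2)).add
      ((((ha'.2.clm_apply hb'.1).sub (hb'.2.clm_apply ha'.1)).fderiv_of_isOpen hO
        le_rfl).const_smul (1 / 2 : ℝ))
  constructor
  · refine hbr.congr fun u hu => ?_
    have h := (hrel u hu).1
    rw [courant_vecSection] at h
    rw [coordVec_of_mem_target _ hu.1, ← h]
    exact DFunLike.congr_fun (chartDeriv_comp_mfderiv_symm hu.1) _
  · refine hform.congr fun u hu => ?_
    have h := (hrel u hu).2
    rw [courant_vecSection] at h
    exact h.symm

end CourantSmooth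

section Closedness

open Filter Topology

variable {F : Type*} [NormedAddCommGroup F] [NormedSpace ℝ F]
  {H : Type*} [TopologicalSpace H] {I : ModelWithCorners ℝ F H} [I.Boundaryless]
  {M : Type*} [TopologicalSpace M] [ChartedSpace H M] [IsManifold I ∞ M] {x₀ x : M}

/-- The fibre of the big tangent bundle at `x`, read in the preferred chart around `x₀`. -/
noncomputable def bigCoord (I : ModelWithCorners ℝ F H) (x₀ x : M) :
    BigTangent I x →ₗ[ℝ] F × (F →L[ℝ] ℝ) where
  toFun p := (chartDeriv I x₀ x p.1, p.2.comp (chartDeriv I x₀ x).inverse)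
  map_add' _ _ := Prod.ext (map_add _ _ _) (ContinuousLinearMap.add_comp _ _ _)
  map_smul' _ _ := Prod.ext (map_smul _ _ _) (ContinuousLinearMap.smul_comp _ _ _)

omit [I.Boundaryless] in
lemma inverse_chartDeriv_comp (hx : x ∈ (extChartAt I x₀).source) :
    (chartDeriv I x₀ x).inverse.comp (chartDeriv I x₀ x) =
      ContinuousLinearMap.id ℝ (TangentSpace I x) := by
  have hinv : (chartDeriv I x₀ x).IsInvertible := isInvertible_mfderiv_extChartAt hx
  ext v
  exact hinv.inverse_apply_eq.2 rfl

omit [I.Boundaryless] in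
lemma bigCoord_injective (hx : x ∈ (extChartAt I x₀).source) :
    Function.Injective (bigCoord I x₀ x) := by
  rintro ⟨X, α⟩ ⟨Y, β⟩ h
  obtain ⟨h1, h2⟩ := Prod.mk.inj h
  refine Prod.ext ((chartDeriv_bijective hx).1 h1) ?_
  have h3 := congrArg (fun L : F →L[ℝ] ℝ => L.comp (chartDeriv I x₀ x)) h2
  simp only [ContinuousLinearMap.comp_assoc, inverse_chartDeriv_comp hx] at h3
  exact h3

lemma bigCoord_section (s : ∀ x : M, BigTangent I x) (hx : x ∈ (extChartAt I x₀).source) :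
    bigCoord I x₀ x (s x) = (coordVec I x₀ (fun z => (s z).1) (extChartAt I x₀ x),
      coordForm I x₀ (fun z => (s z).2) (extChartAt I x₀ x)) := by
  refine Prod.ext (coordVec_chart (fun z => (s z).1) hx).symm ?_
  change (s x).2.comp (chartDeriv I x₀ x).inverse = _
  rw [← coordForm_comp_chartDeriv (fun z => (s z).2) hx]
  ext v
  obtain ⟨w, rfl⟩ := (chartDeriv_bijective hx).2 v
  exact congrArg (fun v => coordForm I x₀ (fun z => (s z).2) (extChartAt I x₀ x)
    (chartDeriv I x₀ x v)) (DFunLike.congr_fun (inverse_chartDeriv_comp hx) w)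

lemma IsSmoothOn.continuousAt_bigCoord {s : ∀ x : M, BigTangent I x} {U : Set M}
    (hs : IsSmoothOn I s U) (hU : IsOpen U) (hxU : x ∈ U) (hx : x ∈ (extChartAt I x₀).source) :
    ContinuousAt (fun z => bigCoord I x₀ z (s z)) x := by
  have h := hs.contDiffAt_coord hU hxU hx
  refine ((h.1.continuousAt.prodMk h.2.continuousAt).comp
    (continuousAt_extChartAt' hx)).congr ?_
  filter_upwards [(isOpen_extChartAt_source x₀).mem_nhds hx] with z hz
  exact (bigCoord_section s hz).symm

/-- A smooth section that takes values in a smooth subbundle on a dense set does so everywhere. -/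
lemma IsSmoothSubbundle.mem_of_dense {k : ℕ} {E : ∀ x : M, Submodule ℝ (BigTangent I x)}
    (hE : IsSmoothSubbundle I k E) {c : ∀ x : M, BigTangent I x}
    (hc : IsSmoothOn I c Set.univ) {D : Set M} (hD : Dense D) (hcD : ∀ x ∈ D, c x ∈ E x) (x : M) :
    c x ∈ E x := by
  obtain ⟨U, hU, hxU, s, hs, hspan⟩ := hE x
  by_contra hcx
  rw [(hspan x hxU).2] at hcx
  have hx := mem_extChartAt_source (I := I) x
  have hli := (linearIndependent_finCons.2 ⟨(hspan x hxU).1, hcx⟩).map'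
    (bigCoord I x x) (LinearMap.ker_eq_bot.2 (bigCoord_injective hx))
  let T : M → Fin (k + 1) → F × (F →L[ℝ] ℝ) := fun z =>
    bigCoord I x z ∘ Fin.cons (α := fun _ => BigTangent I z) (c z) fun i => s i z
  have hT : ContinuousAt T x := by
    refine continuousAt_pi.2 fun i => ?_
    refine Fin.cases ?_ (fun j => ?_) i
    · exact hc.continuousAt_bigCoord isOpen_univ (Set.mem_univ x) hx
    · exact (hs j).continuousAt_bigCoord hU hxU hx
  have hev : ∀ᶠ z in 𝓝 x, LinearIndependent ℝ (T z) := hT.eventually hli.eventually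
  obtain ⟨z, hzD, hz, hzU⟩ := hD.inter_nhds_nonempty (hev.and (hU.mem_nhds hxU))
  have hz' := hz.of_comp
  rw [linearIndependent_finCons] at hz'
  exact hz'.2 ((hspan z hzU).2 ▸ hcD z hzD)

end Closedness

section Extension

open Filter Topology

variable {F : Type*} [NormedAddCommGroup F] [NormedSpace ℝ F]
  {H : Type*} [TopologicalSpace H] {I : ModelWithCorners ℝ F H}
  {F' : Type*} [NormedAddCommGroup F'] [NormedSpace ℝ F']
  {H' : Type*} [TopologicalSpace H'] {J : ModelWithCorners ℝ F' H'}
  {N : Type*} [TopologicalSpace N] [ChartedSpace H N] [IsManifold I ∞ N]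
  {M : Type*} [TopologicalSpace M] [ChartedSpace H' M] [IsManifold J ∞ M]
  {f : N → M} {x : N}

/-- A linear combination of sections with variable coefficients. -/
noncomputable def combination {k : ℕ} (c : Fin k → M → ℝ) (s : Fin k → ∀ y : M, BigTangent J y) :
    ∀ y : M, BigTangent J y :=
  fun y => ∑ i, c i y • s i y

lemma isSmoothOn_combination {k : ℕ} {c : Fin k → M → ℝ} {s : Fin k → ∀ y : M, BigTangent J y}
    {U : Set M} (hc : ∀ i, ContMDiffOn J 𝓘(ℝ, ℝ) ∞ (c i) U) (hs : ∀ i, IsSmoothOn J (s i) U) :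
    IsSmoothOn J (combination c s) U := by
  constructor
  · refine (ContMDiffOn.sum_section (s := Finset.univ)
      fun i _ => (hc i).smul_section (hs i).1).congr fun y _ => ?_
    simp [combination, Prod.fst_sum]
  · refine (ContMDiffOn.sum_section (s := Finset.univ)
      fun i _ => (hc i).smul_section (hs i).2).congr fun y _ => ?_
    simp [combination, Prod.snd_sum]

lemma IsSmoothOn.smul_of_tsupport {s : ∀ y : M, BigTangent J y} {U : Set M} {χ : M → ℝ}
    (hs : IsSmoothOn J s U) (hU : IsOpen U) (hχ : ContMDiff J 𝓘(ℝ, ℝ) ∞ χ) (hχU : tsupport χ ⊆ U) :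
    IsSmoothOn J (fun y => χ y • s y) Set.univ :=
  ⟨(hχ.contMDiffOn.smul_section_of_tsupport hU hχU hs.1).contMDiffOn,
    (hχ.contMDiffOn.smul_section_of_tsupport hU hχU hs.2).contMDiffOn⟩

omit [IsManifold I ∞ N] [IsManifold J ∞ M] in
/-- An immersion has a smooth local left inverse. -/
lemma exists_local_retraction [I.Boundaryless] (hf : Manifold.IsImmersionAt I J ∞ f x) :
    ∃ (ρ : M → N) (V : Set M), IsOpen V ∧ f x ∈ V ∧ ContMDiffOn J I ∞ ρ V ∧
      ∀ᶠ z in 𝓝 x, ρ (f z) = z := by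
  let p : F' → F := fun v => (hf.equiv.symm v).1
  have hp : ContDiff ℝ ∞ p := contDiff_fst.comp hf.equiv.symm.contDiff
  have hpf : ∀ z ∈ hf.domChart.source,
      p (hf.codChart.extend J (f z)) = hf.domChart.extend I z := by
    intro z hz
    have hz' : z ∈ (hf.domChart.extend I).source := by
      rwa [OpenPartialHomeomorph.extend_source]
    have h := hf.writtenInCharts ((hf.domChart.extend I).map_source hz')
    simp only [Function.comp_apply, (hf.domChart.extend I).left_inv hz'] at h
    simp only [p]
    rw [h]
    simp
  have hcod := hf.codChart.contMDiffOn_extend hf.codChart_mem_maximalAtlas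
  refine ⟨(hf.domChart.extend I).symm ∘ p ∘ hf.codChart.extend J,
    hf.codChart.source ∩ (hf.codChart.extend J) ⁻¹' (p ⁻¹' (hf.domChart.extend I).target),
    hcod.continuousOn.isOpen_inter_preimage hf.codChart.open_source
      (hf.domChart.isOpen_extend_target.preimage hp.continuous),
    ⟨hf.mem_codChart_source, ?_⟩, ?_, ?_⟩
  · change p (hf.codChart.extend J (f x)) ∈ (hf.domChart.extend I).target
    rw [hpf x hf.mem_domChart_source]
    exact (hf.domChart.extend I).map_source (by
      rw [OpenPartialHomeomorph.extend_source]; exact hf.mem_domChart_source)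
  · exact (contMDiffOn_extend_symm hf.domChart_mem_maximalAtlas).comp
      (hp.contMDiff.comp_contMDiffOn (hcod.mono Set.inter_subset_left)) fun y hy => by
        have := hy.2
        rw [OpenPartialHomeomorph.extend_target'] at this
        exact this
  · filter_upwards [hf.domChart.open_source.mem_nhds hf.mem_domChart_source] with z hz
    simp only [Function.comp_apply]
    rw [hpf z hz]
    exact (hf.domChart.extend I).left_inv (by rwa [OpenPartialHomeomorph.extend_source])

omit [IsManifold I ∞ N] in
/-- A combination, with coefficients smooth on the source of an immersion, of local sections of `E`
extends near a point to a global section of `E`. -/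
lemma exists_section_extending [I.Boundaryless] [FiniteDimensional ℝ F'] [T2Space M] {k : ℕ}
    {E : ∀ y : M, Submodule ℝ (BigTangent J y)} (hf : Manifold.IsImmersionAt I J ∞ f x)
    {V : Set M} (hV : IsOpen V) (hxV : f x ∈ V) {s : Fin k → ∀ y : M, BigTangent J y}
    (hs : ∀ i, IsSmoothOn J (s i) V) (hsE : ∀ i, ∀ y ∈ V, s i y ∈ E y)
    {O : Set N} (hO : IsOpen O) (hxO : x ∈ O) {c : Fin k → N → ℝ}
    (hc : ∀ i, ContMDiffOn I 𝓘(ℝ, ℝ) ∞ (c i) O) :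
    ∃ t ∈ sections J E, ∀ᶠ z in 𝓝 x, t (f z) = ∑ i, c i z • s i (f z) := by
  obtain ⟨ρ, W, hW, hxW, hρ, hρf⟩ := exists_local_retraction hf
  have hρx : ρ (f x) = x := hρf.self_of_nhds
  have hfc : ContinuousAt f x := hf.continuousAt
  have hV' : IsOpen (W ∩ ρ ⁻¹' O ∩ V) := (hρ.continuousOn.isOpen_inter_preimage hW hO).inter hV
  have hxV' : f x ∈ W ∩ ρ ⁻¹' O ∩ V := ⟨⟨hxW, by
    change ρ (f x) ∈ O
    rwa [hρx]⟩, hxV⟩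
  obtain ⟨χ, hχ⟩ := ((SmoothBumpFunction.nhds_basis_tsupport (I := J) (f x)).mem_iff).1
    (hV'.mem_nhds hxV')
  have hcomb : IsSmoothOn J (combination (fun i => c i ∘ ρ) s) (W ∩ ρ ⁻¹' O ∩ V) :=
    isSmoothOn_combination
      (fun i => (hc i).comp (hρ.mono fun y hy => hy.1.1) fun y hy => hy.1.2)
      fun i => (hs i).mono Set.inter_subset_right
  refine ⟨fun y => χ y • combination (fun i => c i ∘ ρ) s y,
    ⟨hcomb.smul_of_tsupport hV' χ.contMDiff hχ.2, fun y => ?_⟩, ?_⟩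
  · by_cases hy : y ∈ tsupport χ
    · exact (E y).smul_mem _ (Submodule.sum_mem _ fun i _ =>
        (E y).smul_mem _ (hsE i y (hχ.2 hy).2))
    · simp only [image_eq_zero_of_notMem_tsupport hy, zero_smul, Submodule.zero_mem]
  · filter_upwards [hρf, hfc.eventually χ.eventuallyEq_one] with z hz hz1
    simp only [combination, Function.comp_apply, hz]
    rw [hz1, Pi.one_apply, one_smul]

end Extension

section Integrability

open Filter Topology

variable {F : Type*} [NormedAddCommGroup F] [NormedSpace ℝ F]
  {H : Type*} [TopologicalSpace H] {I : ModelWithCorners ℝ F H}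
  {F' : Type*} [NormedAddCommGroup F'] [NormedSpace ℝ F']
  {H' : Type*} [TopologicalSpace H'] {J : ModelWithCorners ℝ F' H'}
  {N : Type*} [TopologicalSpace N] [ChartedSpace H N]
  {M : Type*} [TopologicalSpace M] [ChartedSpace H' M]
  {f : N → M}

lemma coordVec_sum {k : ℕ} (y₀ : M) (c : Fin k → ℝ) (s : Fin k → ∀ y : M, BigTangent J y)
    (v : F') :
    coordVec J y₀ (fun y => (∑ i, c i • s i y).1) v =
      ∑ i, c i • coordVec J y₀ (fun y => (s i y).1) v := by
  let D : TangentSpace J ((extChartAt J y₀).symm v) →L[ℝ] F' :=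
    (mfderiv 𝓘(ℝ, F') J (extChartAt J y₀).symm v).inverse
  refine (congrArg D Prod.fst_sum).trans ((map_sum D _ _).trans ?_)
  exact Finset.sum_congr rfl fun i _ => map_smul D _ _

lemma coordForm_sum {k : ℕ} (y₀ : M) (c : Fin k → ℝ) (s : Fin k → ∀ y : M, BigTangent J y)
    (v : F') :
    coordForm J y₀ (fun y => (∑ i, c i • s i y).2) v =
      ∑ i, c i • coordForm J y₀ (fun y => (s i y).2) v := by
  ext w
  simp only [coordForm, cotangentMap, Prod.snd_sum, Prod.smul_snd]
  rw [ContinuousLinearMap.finsetSum_comp]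
  rfl

lemma Related.congr {a : ∀ x : N, BigTangent I x} {b b' : ∀ y : M, BigTangent J y} {x : N}
    (h : Related I J f a b x) (hb : b' (f x) = b (f x)) : Related I J f a b' x := by
  rw [Related, hb]
  exact h

lemma Related.mem_pullback {a : ∀ x : N, BigTangent I x} {b : ∀ y : M, BigTangent J y} {x : N}
    (h : Related I J f a b x) {S : Submodule ℝ (BigTangent J (f x))} (hb : b (f x) ∈ S) :
    a x ∈ pullback I J f x S :=
  ⟨(b (f x)).2, h.2, by rw [h.1]; exact hb⟩

variable [I.Boundaryless] [J.Boundaryless] [IsManifold I ∞ N] [IsManifold J ∞ M]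
  [FiniteDimensional ℝ F] [FiniteDimensional ℝ F'] [T2Space M]

/-- The points where the Courant bracket of two sections of `f^*E` lies in `f^*E` are dense. -/
lemma exists_courant_mem_pullback (hf : ContMDiff I J ∞ f)
    (himm : ∀ x, Manifold.IsImmersionAt I J ∞ f x) {k : ℕ}
    {E : ∀ y : M, Submodule ℝ (BigTangent J y)} (hE : IsSmoothSubbundle J k E)
    (hint : IsIntegrable J E) {a b : ∀ x : N, BigTangent I x}
    (ha : a ∈ sections I fun x => pullback I J f x (E (f x)))
    (hb : b ∈ sections I fun x => pullback I J f x (E (f x)))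
    {W : Set N} (hW : IsOpen W) (hne : W.Nonempty) :
    ∃ x ∈ W, courant I a b x ∈ pullback I J f x (E (f x)) := by
  obtain ⟨x₁, hx₁⟩ := hne
  obtain ⟨V, hV, hxV, s, hs, hspan⟩ := hE (f x₁)
  have hsE : ∀ i, ∀ y ∈ V, s i y ∈ E y := fun i y hy => by
    rw [(hspan y hy).2]
    exact Submodule.subset_span ⟨i, rfl⟩
  set y₁ := f x₁ with hy₁
  let O : Set N := W ∩ (extChartAt I x₁).source ∩ f ⁻¹' (V ∩ (extChartAt J y₁).source)
  have hO : IsOpen O := (hW.inter (isOpen_extChartAt_source x₁)).inter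
    ((hV.inter (isOpen_extChartAt_source y₁)).preimage hf.continuous)
  let G := coordMap I J f x₁ y₁
  let A : F → Fin k → F' × (F →L[ℝ] ℝ) := fun u i =>
    (coordVec J y₁ (fun y => (s i y).1) (G u),
      (coordForm J y₁ (fun y => (s i y).2) (G u)).comp (fderiv ℝ G u))
  let B : (∀ x : N, BigTangent I x) → F → F' × (F →L[ℝ] ℝ) := fun a u =>
    (fderiv ℝ G u (coordVec I x₁ (fun z => (a z).1) u), coordForm I x₁ (fun z => (a z).2) u)
  have hΩ : IsOpen (chartImage I x₁ O) := isOpen_chartImage hO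
  have hΩne : (chartImage I x₁ O).Nonempty := ⟨_, extChartAt_mem_chartImage
    (mem_extChartAt_source x₁) ⟨⟨hx₁, mem_extChartAt_source x₁⟩, hxV, mem_extChartAt_source y₁⟩⟩
  have hpt : ∀ u ∈ chartImage I x₁ O, ∃ z ∈ O, u = extChartAt I x₁ z := fun u hu =>
    ⟨_, hu.2, ((extChartAt I x₁).right_inv hu.1).symm⟩
  have hG : ∀ z ∈ O, ContDiffAt ℝ ∞ G (extChartAt I x₁ z) := fun z hz =>
    contDiffAt_coordMap (hf z) hz.1.2 hz.2.2
  have hA : ∀ i, ContDiffOn ℝ ∞ (fun u => A u i) (chartImage I x₁ O) := by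
    intro i u hu
    obtain ⟨z, hz, rfl⟩ := hpt u hu
    have h := (hs i).contDiffAt_coord hV hz.2.1 hz.2.2
    rw [← coordMap_chart (I := I) (J := J) (f := f) (y₀ := y₁) hz.1.2] at h
    exact ((h.1.comp _ (hG z hz)).prodMk ((h.2.comp _ (hG z hz)).clm_comp
      ((hG z hz).fderiv_right le_rfl))).contDiffWithinAt
  have hB : ∀ a : ∀ x : N, BigTangent I x, IsSmoothOn I a Set.univ →
      ContDiffOn ℝ ∞ (B a) (chartImage I x₁ O) := by
    intro a ha u hu
    obtain ⟨z, hz, rfl⟩ := hpt u hu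
    have h := ha.contDiffAt_coord isOpen_univ (Set.mem_univ z) hz.1.2
    exact ((((hG z hz).fderiv_right le_rfl).clm_apply h.1).prodMk h.2).contDiffWithinAt
  have hrel : ∀ (a : ∀ x : N, BigTangent I x) (c : Fin k → ℝ), ∀ z ∈ O,
      (Related I J f a (fun y => ∑ i, c i • s i y) z ↔
        ∑ i, c i • A (extChartAt I x₁ z) i = B a (extChartAt I x₁ z)) := by
    intro a c z hz
    rw [related_iff_coord (hf z) hz.1.2 hz.2.2, coordVec_sum, coordForm_sum, Prod.ext_iff,
      Prod.fst_sum, Prod.snd_sum, ContinuousLinearMap.finsetSum_comp]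
    exact and_congr Iff.rfl eq_comm
  have hBA : ∀ a ∈ sections I fun x => pullback I J f x (E (f x)), ∀ u ∈ chartImage I x₁ O,
      B a u ∈ Submodule.span ℝ (Set.range (A u)) := by
    intro a ha u hu
    obtain ⟨z, hz, rfl⟩ := hpt u hu
    obtain ⟨α, hα, hmem⟩ := ha.2 z
    rw [(hspan _ hz.2.1).2, Submodule.mem_span_range_iff_exists_fun] at hmem
    obtain ⟨c, hc⟩ := hmem
    rw [Submodule.mem_span_range_iff_exists_fun]
    refine ⟨c, (hrel a c z hz).1 ⟨?_, ?_⟩⟩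
    · exact congrArg Prod.fst hc.symm
    · exact hα.trans (congrArg (fun p => cotangentMap I J f z p.2) hc.symm)
  obtain ⟨Ω', hΩ'Ω, hΩ', ⟨u₀, hu₀⟩, hsol⟩ := exists_contDiffOn_coefficients hΩ hΩne A hA
  obtain ⟨x, hxO, rfl⟩ := hpt u₀ (hΩ'Ω hu₀)
  let O' : Set N := (extChartAt I x₁).source ∩ extChartAt I x₁ ⁻¹' Ω' ∩ O
  have hO' : IsOpen O' :=
    ((continuousOn_extChartAt x₁).isOpen_inter_preimage (isOpen_extChartAt_source x₁) hΩ').inter hO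
  have hxO' : x ∈ O' := ⟨⟨hxO.1.2, hu₀⟩, hxO⟩
  have hlift : ∀ a ∈ sections I fun x => pullback I J f x (E (f x)),
      ∃ t ∈ sections J E, ∀ᶠ z in 𝓝 x, Related I J f a t z := by
    intro a ha
    obtain ⟨c, hc, hcA⟩ := hsol (B a) (hB a ha.1) (hBA a ha)
    have hφ : ContMDiffOn I 𝓘(ℝ, F) ∞ (extChartAt I x₁) O' := contMDiffOn_extChartAt.mono
      fun z hz => by
        rw [← extChartAt_source (I := I)]
        exact hz.1.1
    obtain ⟨t, ht, htc⟩ := exists_section_extending (himm x) hV hxO.2.1 hs hsE hO' hxO'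
      (c := fun i => c i ∘ extChartAt I x₁)
      fun i => (hc i).contMDiffOn.comp hφ fun z hz => hz.1.2
    refine ⟨t, ht, ?_⟩
    filter_upwards [htc, hO'.mem_nhds hxO'] with z hz hzO
    exact ((hrel a (fun i => c i (extChartAt I x₁ z)) z hzO.2).2
      (hcA _ hzO.1.2)).congr hz
  obtain ⟨t, ht, hta⟩ := hlift a ha
  obtain ⟨t', ht', htb⟩ := hlift b hb
  obtain ⟨U, hU, hUo, hxU⟩ := mem_nhds_iff.1 (hta.and htb)
  refine ⟨x, hxO.1.1, ?_⟩
  exact (courant_related hUo hxU isOpen_univ (Set.mem_univ _) hf.contMDiffOn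
    (ha.1.mono (Set.subset_univ U)) (hb.1.mono (Set.subset_univ U)) ht.1 ht'.1
    (fun z hz => (hU hz).1) (fun z hz => (hU hz).2)).mem_pullback ((hint t ht t' ht').2 (f x))

/-- The pullback of an integrable smooth subbundle by an immersion is integrable when it is a
smooth subbundle. -/
lemma IsIntegrable.pullback (hf : ContMDiff I J ∞ f)
    (himm : ∀ x, Manifold.IsImmersionAt I J ∞ f x) {k r : ℕ}
    {E : ∀ y : M, Submodule ℝ (BigTangent J y)} (hE : IsSmoothSubbundle J k E)
    (hint : IsIntegrable J E)
    (hr : IsSmoothSubbundle I r fun x => pullback I J f x (E (f x))) :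
    IsIntegrable I fun x => BigIsotropic.pullback I J f x (E (f x)) := by
  intro a ha b hb
  have hc := IsSmoothOn.courant isOpen_univ ha.1 hb.1
  refine ⟨hc, hr.mem_of_dense hc
    (D := {x | courant I a b x ∈ BigIsotropic.pullback I J f x (E (f x))}) ?_ fun x hx => hx⟩
  refine dense_iff_inter_open.2 fun W hW hne => ?_
  obtain ⟨x, hx, hx'⟩ := exists_courant_mem_pullback hf himm hE hint ha hb hW hne
  exact ⟨x, hx, hx'⟩

omit [I.Boundaryless] [J.Boundaryless] [FiniteDimensional ℝ F'] [T2Space M] in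
lemma exists_isBigIsotropic_pullback {k r : ℕ} {E : ∀ y : M, Submodule ℝ (BigTangent J y)}
    (hE : IsBigIsotropic J k E)
    (hr : IsSmoothSubbundle I r fun x => pullback I J f x (E (f x))) :
    ∃ r : ℕ, IsBigIsotropic I r fun x => BigIsotropic.pullback I J f x (E (f x)) := by
  have hiso : ∀ x : N, IsIsotropic I x (pullback I J f x (E (f x))) := fun x =>
    (hE.isotropic (f x)).pullback
  rcases isEmpty_or_nonempty N with hN | ⟨⟨x⟩⟩
  · exact ⟨0, Nat.zero_le _, fun x => (hN.false x).elim, hiso⟩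
  · refine ⟨r, ?_, hr, hiso⟩
    rw [← hr.finrank_eq x]
    exact (hiso x).finrank_le

end Integrability

end BigIsotropic

theorem proposition4p1 {n m k : ℕ}
    {N : Type*} [TopologicalSpace N] [T2Space N] [ChartedSpace (EuclideanSpace ℝ (Fin n)) N]
    [IsManifold (𝓡 n) ∞ N]
    {M : Type*} [TopologicalSpace M] [T2Space M] [ChartedSpace (EuclideanSpace ℝ (Fin m)) M]
    [IsManifold (𝓡 m) ∞ M]
    (f : N → M) (hf : ContMDiff (𝓡 n) (𝓡 m) ∞ f)
    (E : ∀ y : M, Submodule ℝ (BigIsotropic.BigTangent (𝓡 m) y))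
    (hE : BigIsotropic.IsBigIsotropic (𝓡 m) k E) :
    (∀ x : N,
      BigIsotropic.IsIsotropic (𝓡 n) x (BigIsotropic.pullback (𝓡 n) (𝓡 m) f x (E (f x))) ∧
      BigIsotropic.perp (𝓡 n) x (BigIsotropic.pullback (𝓡 n) (𝓡 m) f x (E (f x))) =
        BigIsotropic.pullback (𝓡 n) (𝓡 m) f x (BigIsotropic.perp (𝓡 m) (f x) (E (f x)))) ∧
    (Manifold.IsSmoothEmbedding (𝓡 n) (𝓡 m) ∞ f →
      BigIsotropic.IsIntegrable (𝓡 m) E →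
      (∃ r : ℕ, BigIsotropic.IsSmoothSubbundle (𝓡 n) r
        (fun x => BigIsotropic.pullback (𝓡 n) (𝓡 m) f x (E (f x)))) →
      (∃ r : ℕ, BigIsotropic.IsBigIsotropic (𝓡 n) r
        (fun x => BigIsotropic.pullback (𝓡 n) (𝓡 m) f x (E (f x)))) ∧
      BigIsotropic.IsIntegrable (𝓡 n)
        (fun x => BigIsotropic.pullback (𝓡 n) (𝓡 m) f x (E (f x)))) ∧
    (∀ x : N,
      (Module.finrank ℝ (BigIsotropic.pullback (𝓡 n) (𝓡 m) f x (E (f x))) : ℤ)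
          = (n : ℤ) - (m : ℤ) + (k : ℤ) ↔
        E (f x) ⊓ BigIsotropic.kerCotangentMap (𝓡 n) (𝓡 m) f x =
          BigIsotropic.perp (𝓡 m) (f x) (E (f x)) ⊓
            BigIsotropic.kerCotangentMap (𝓡 n) (𝓡 m) f x) := by
  refine ⟨fun x => ⟨(hE.isotropic (f x)).pullback, BigIsotropic.perp_pullback f x _⟩, ?_, ?_⟩
  · rintro hemb hint ⟨r, hr⟩
    exact ⟨BigIsotropic.exists_isBigIsotropic_pullback hE hr,
      hint.pullback hf (fun x => hemb.isImmersion.isImmersionAt x) hE.smooth hr⟩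
  · intro x
    have h := BigIsotropic.finrank_pullback_eq_iff (I := 𝓡 n) (hE.isotropic (f x))
    rwa [hE.smooth.finrank_eq, finrank_euclideanSpace_fin, finrank_euclideanSpace_fin] at h
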